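/- Let $d\ge 1$, $\rho>0$, and let $\mathsf G(t)$, $t>0$, be the relaxation modulus of a viscoelastic solid: for each $t>0$, $\mathsf G(t)$ is a symmetric operator on the space $S$ of real symmetric $d\times d$ matrices with the scalar product $\langle \mathbf E,\mathbf F\rangle=\sum_{i,j}E_{ij}F_{ij}$, with components $G_{ijkl}(t)$; for every $\mathbf E\in S$ the function $t\mapsto\langle \mathbf E,\mathsf G(t)\mathbf E\rangle$ is completely monotonic on $]0,\infty[$; $\lim_{t\to0+}\mathsf G(t)$ exists and is finite; and $\lim_{t\to\infty}\mathsf G(t)$ is positive definite. Let $\mathbf n\in\mathbb R^d$ be a unit vector. For $\operatorname{Re}p>0$ put $$Q_{ijkl}(p)=p\int_0^\infty e^{-pt}G_{ijkl}(t)\,dt ,$$ extend $Q_{ijkl}$ by continuity to $\operatorname{Re}p\ge 0$, and let $\mathbf Q_{\mathbf n}(p)$ be the matrix with entries $\sum_{j,l}Q_{ijkl}(p)n_jn_l$, and $\mathbf G_{\mathbf n}(t)$ the matrix with entries $\sum_{j,l}G_{ijkl}(t)n_jn_l$. Let $$\mathbf K_{\mathbf n}(p)=\rho^{1/2}\,p\,\mathbf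 Q_{\mathbf n}(p)^{-1/2},\qquad \operatorname{Re}p\ge0,$$ where $\mathbf Q_{\mathbf n}(p)^{-1/2}$ is the inverse of the principal square root (the square root whose eigenvalues all have positive real part). Let $\operatorname{Re}p\ge 0$. Then $\mathbf K_{\mathbf n}(p)\ne0$ if and only if $p\neq 0$. Assume that $\mathbf K_{\mathbf n}(p)\neq0$ and, in case $p$ lies on the imaginary axis, assume also that the medium has no purely elastic mode in the direction $\mathbf n$, that is, there are no $\mathbf v\in\mathbb R^d\setminus\{0\}$ and $c\in\mathbb R$ with $\mathbf G_{\mathbf n}(t)\mathbf v=c\,\mathbf v$ for all $t>0$. Then the spectrum of $\mathbf K_{\mathbf n}(p)$ lies in the open right half-plane $\{z\in\mathbb C:\operatorname{Re}z>0\}$. -/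

import Mathlib

open Filter Topology MeasureTheory
open scoped ContDiff Matrix

noncomputable section

namespace Viscoelastic

/-- Components `C i j k l` of a rank-4 tensor on `ℝ^d`, in a fixed orthonormal coordinate system. -/
abbrev Tensor4 (R : Type*) (d : ℕ) := Fin d → Fin d → Fin d → Fin d → R

/-- `C` represents a symmetric operator `E ↦ C E`, `(C E) i j = ∑ k l, C i j k l * E k l`, on the
space of symmetric rank-2 tensors: it has the minor and the major symmetries. -/
def IsSymmTensor4 {d : ℕ} (C : Tensor4 ℝ d) : Prop :=
  ∀ i j k l, C i j k l = C j i k l ∧ C i j k l = C i j l k ∧ C i j k l = C k l i j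

/-- The quadratic form `⟨E, C E⟩ = E_ij C_ijkl E_kl`. -/
def quadForm {d : ℕ} (C : Tensor4 ℝ d) (E : Matrix (Fin d) (Fin d) ℝ) : ℝ :=
  ∑ i, ∑ j, ∑ k, ∑ l, E i j * C i j k l * E k l

/-- Completely monotonic functions on `]0, ∞[`. -/
def IsCompletelyMonotonic (f : ℝ → ℝ) : Prop :=
  ContDiffOn ℝ ∞ f (Set.Ioi 0) ∧
    ∀ m : ℕ, ∀ t : ℝ, 0 < t → 0 ≤ (-1 : ℝ) ^ m * iteratedDerivWithin m f (Set.Ioi 0) t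

/-- `G` is the relaxation modulus of a viscoelastic solid: a completely monotonic function on
`]0, ∞[` with values in the symmetric operators on symmetric rank-2 tensors, with a finite limit
at `0` (hence locally integrable) and a positive definite limit at `∞`. -/
structure IsSolidRelaxationModulus {d : ℕ} (G : ℝ → Tensor4 ℝ d) : Prop where
  symm : ∀ t : ℝ, 0 < t → IsSymmTensor4 (G t)
  completelyMonotonic : ∀ E : Matrix (Fin d) (Fin d) ℝ, E.IsSymm →
    IsCompletelyMonotonic fun t => quadForm (G t) E
  limit_zero : ∃ G₀ : Tensor4 ℝ d, Tendsto G (𝓝[>] 0) (𝓝 G₀)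
  limit_infty : ∃ G₁ : Tensor4 ℝ d, Tendsto G atTop (𝓝 G₁) ∧
    ∀ E : Matrix (Fin d) (Fin d) ℝ, E.IsSymm → E ≠ 0 → 0 < quadForm G₁ E

/-- The matrix `C_n` with entries `(C_n)_ik = C_ijkl n_j n_l`. -/
def acousticMatrix {R : Type*} [AddCommMonoid R] [Module ℝ R] {d : ℕ} (C : Tensor4 R d)
    (n : EuclideanSpace ℝ (Fin d)) : Matrix (Fin d) (Fin d) R :=
  Matrix.of fun i k => ∑ j, ∑ l, (n j * n l) • C i j k l

/-- `p ∫_0^∞ e^{-p t} G(t) dt`, componentwise, for `Re p > 0`. -/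
def laplaceModulus {d : ℕ} (G : ℝ → Tensor4 ℝ d) (p : ℂ) : Tensor4 ℂ d :=
  fun i j k l => p * ∫ t in Set.Ioi (0 : ℝ), Complex.exp (-p * (t : ℂ)) * (G t i j k l : ℂ)

/-- The complex modulus `Q(p)` on the closed right half-plane: `p` times the Laplace transform of
`G` where `Re p > 0`, extended by continuity to `Re p = 0`, where the Laplace integral need not
converge. -/
def modulus {d : ℕ} (G : ℝ → Tensor4 ℝ d) (p : ℂ) : Tensor4 ℂ d :=
  open Classical in
  if 0 < p.re then laplaceModulus G p
  else limUnder (𝓝[{z : ℂ | 0 < z.re}] p) (laplaceModulus G)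

/-- `Y` is a principal square root of `B`: a square root with spectrum in the open right
half-plane. There is at most one. -/
def IsPrincipalSqrt {d : ℕ} (B Y : Matrix (Fin d) (Fin d) ℂ) : Prop :=
  Y * Y = B ∧ ∀ z ∈ spectrum ℂ Y, 0 < z.re

/-- The principal square root of `B` (`0` if there is none). -/
def principalSqrt {d : ℕ} (B : Matrix (Fin d) (Fin d) ℂ) : Matrix (Fin d) (Fin d) ℂ :=
  open Classical in
  if h : ∃ Y, IsPrincipalSqrt B Y then h.choose else 0

/-- `K_n(p) = ρ^{1/2} p Q_n(p)^{-1/2}`. -/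
def waveMatrix {d : ℕ} (ρ : ℝ) (G : ℝ → Tensor4 ℝ d) (n : EuclideanSpace ℝ (Fin d)) (p : ℂ) :
    Matrix (Fin d) (Fin d) ℂ :=
  ((Real.sqrt ρ : ℂ) * p) • (principalSqrt (acousticMatrix (modulus G p) n))⁻¹

/-- A purely elastic mode in direction `n`: a fixed nonzero polarization `v` which is an
eigenvector of `G_n(t)` with an eigenvalue that does not depend on `t`, so that it does not
relax at all. -/
def HasElasticMode {d : ℕ} (G : ℝ → Tensor4 ℝ d) (n : EuclideanSpace ℝ (Fin d)) : Prop :=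
  ∃ v : Fin d → ℝ, v ≠ 0 ∧ ∃ c : ℝ, ∀ t : ℝ, 0 < t → acousticMatrix (G t) n *ᵥ v = c • v

end Viscoelastic

end

/-!
The complex modulus has a representation that makes sense on the whole closed half-plane
`0 ≤ Re p`. If `f` is completely monotonic with a finite limit `a` at `0` and a limit `b` at `∞`,
then `f'` is integrable, and an integration by parts turns `p ∫ exp (-p t) f t dt` into
`F p = a + ∫ exp (-p t) f' t dt` (`laplaceStieltjes`), which is continuous up to the imaginary axis.
By polarization this applies to every component of the relaxation modulus, so no integral
representation of completely monotonic functions is needed. Three facts about `F` carry the proof.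

* `Re F p ≥ b`, because `|∫ exp (-p t) f'| ≤ ∫ |f'| = a - b`
  (`IsCompletelyMonotonic.le_re_laplaceStieltjes`).
* `Im p * Im F p ≥ 0`. Here `Im F p = ∫ sin (Im p * t) g t dt` with the decreasing function
  `g t = -exp (-Re p * t) * f' t`, and integrating by parts once more, with `1 - cos` as a primitive
  of `sin`, shows that such a sine transform has the sign of `Im p` (`mul_integral_sin_nonneg`).
* If `Re p = 0`, `Im p ≠ 0` and `Im F p = 0`, then `f' = 0`
  (`eq_zero_of_integral_sin_eq_zero`).

Let `B` be the acoustic matrix of the modulus at `p`. It is symmetric, so for `v = a + i b` with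
`a`, `b` real, `v* B v` is the sum of the values of `F` for the quadratic forms of `a` and of `b`.
By the first fact the Hermitian part of `B` is positive definite. Hence `ε B` is within distance
less than one of the identity for a small `ε > 0`, and a fixed point argument produces the principal
square root `Y` (`isPrincipalSqrt_principalSqrt`). It is invertible, so `K = √ρ p Y⁻¹` vanishes only
with `p`.

An eigenvalue `z` of `K` is `√ρ p / y` with `y` an eigenvalue of `Y` and `y²` one of `B`. By the
second fact `Im p * Im (y²) ≥ 0`, and since `Re y > 0` also `Im p * Im y ≥ 0`. As `Re z` has the
sign of `Re p * Re y + Im p * Im y`, it is positive if `Re p > 0`. It could vanish for imaginary `p ≠ 0`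
only with `y²` real; by the third fact the quadratic forms of `a` and `b` then do not relax, and as
the derivative of the acoustic matrix is semidefinite, it annihilates `a` and `b`, which makes one
of them an elastic mode (`IsRelaxationMatrix.exists_mulVec_eq_smul_of_im_eigenvalue_eq_zero`).
-/

namespace Viscoelastic

/-! ### Sine integrals of decreasing functions -/

lemma mul_le_setIntegral_of_antitoneOn {g : ℝ → ℝ} (hanti : AntitoneOn g (Set.Ioi 0))
    (hpos : ∀ t, 0 < t → 0 ≤ g t) (hint : IntegrableOn g (Set.Ioi 0)) {t : ℝ} (ht : 0 < t) :
    t * g t ≤ ∫ s in Set.Ioi 0, g s := by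
  have h1 : ∫ _s in Set.Ioc 0 t, g t = t * g t := by
    simp [ht.le]
  rw [← h1]
  calc ∫ _s in Set.Ioc 0 t, g t ≤ ∫ s in Set.Ioc 0 t, g s := by
        refine setIntegral_mono_on (by simp) (hint.mono_set Set.Ioc_subset_Ioi_self)
          measurableSet_Ioc fun s hs => hanti hs.1 ht hs.2
    _ ≤ ∫ s in Set.Ioi 0, g s := by
        refine setIntegral_mono_set hint ?_ (Set.Ioc_subset_Ioi_self).eventuallyLE
        filter_upwards [ae_restrict_mem measurableSet_Ioi] with s hs using hpos s hs

/-- The boundary-corrected partial sine integral of `g`. Its derivative is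
`-(1 - cos (η t)) g' t`, which makes it monotone as soon as `g` is decreasing. -/
noncomputable def sinPrimitive (g : ℝ → ℝ) (η t : ℝ) : ℝ :=
  η * (∫ s in (0 : ℝ)..t, Real.sin (η * s) * g s) - (1 - Real.cos (η * t)) * g t

lemma integrableOn_sin_mul {g : ℝ → ℝ} (hint : IntegrableOn g (Set.Ioi 0)) (η : ℝ) :
    IntegrableOn (fun s => Real.sin (η * s) * g s) (Set.Ioi 0) := by
  refine Integrable.bdd_mul (c := 1) hint ?_ ?_
  · exact (by fun_prop : Continuous fun s : ℝ => Real.sin (η * s)).aestronglyMeasurable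
  · exact Eventually.of_forall fun s => by
      simpa using Real.abs_sin_le_one (η * s)

section

variable {g g' : ℝ → ℝ} (hderiv : ∀ t, 0 < t → HasDerivAt g (g' t) t)
  (hnonpos : ∀ t, 0 < t → g' t ≤ 0) (hpos : ∀ t, 0 < t → 0 ≤ g t)
  (hint : IntegrableOn g (Set.Ioi 0)) (η : ℝ)

include hderiv hint in
lemma hasDerivAt_sinPrimitive {t : ℝ} (ht : 0 < t) :
    HasDerivAt (sinPrimitive g η) (-((1 - Real.cos (η * t)) * g' t)) t := by
  have hII : IntervalIntegrable (fun s => Real.sin (η * s) * g s) volume 0 t := by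
    rw [intervalIntegrable_iff_integrableOn_Ioc_of_le ht.le]
    exact (integrableOn_sin_mul hint η).mono_set Set.Ioc_subset_Ioi_self
  have hcont : ContinuousOn (fun s => Real.sin (η * s) * g s) (Set.Ioi 0) := by
    refine ContinuousOn.mul (by fun_prop) fun s hs => ?_
    exact (hderiv s hs).continuousAt.continuousWithinAt
  have h1 := intervalIntegral.integral_hasDerivAt_right hII
    (hcont.stronglyMeasurableAtFilter isOpen_Ioi t ht)
    (hcont.continuousAt (Ioi_mem_nhds ht))
  have h2 : HasDerivAt (fun t => Real.cos (η * t)) (-Real.sin (η * t) * (η * 1)) t :=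
    ((hasDerivAt_id t).const_mul η).cos
  have h3 := (h1.const_mul η).sub ((h2.const_sub 1).mul (hderiv t ht))
  refine HasDerivAt.congr_deriv (f := sinPrimitive g η) h3 ?_
  ring

include hderiv hnonpos in
lemma antitoneOn_of_hasDerivAt_nonpos : AntitoneOn g (Set.Ioi 0) := by
  refine antitoneOn_of_hasDerivWithinAt_nonpos (f' := g') (convex_Ioi 0)
    (fun s hs => (hderiv s hs).continuousAt.continuousWithinAt) ?_ ?_
  · intro x hx
    rw [interior_Ioi] at hx
    exact (hderiv x hx).hasDerivWithinAt
  · intro x hx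
    rw [interior_Ioi] at hx
    exact hnonpos x hx

include hderiv hnonpos hint in
lemma monotoneOn_sinPrimitive : MonotoneOn (sinPrimitive g η) (Set.Ioi 0) := by
  refine monotoneOn_of_hasDerivWithinAt_nonneg
    (f' := fun t => -((1 - Real.cos (η * t)) * g' t)) (convex_Ioi 0)
    (fun s hs => (hasDerivAt_sinPrimitive hderiv hint η hs).continuousAt.continuousWithinAt) ?_ ?_
  · intro x hx
    rw [interior_Ioi] at hx
    exact (hasDerivAt_sinPrimitive hderiv hint η hx).hasDerivWithinAt
  · intro x hx
    rw [interior_Ioi] at hx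
    nlinarith [hnonpos x hx, Real.cos_le_one (η * x)]

include hderiv hnonpos hpos hint in
lemma tendsto_sinPrimitive_zero : Tendsto (sinPrimitive g η) (𝓝[>] 0) (𝓝 0) := by
  have hanti := antitoneOn_of_hasDerivAt_nonpos hderiv hnonpos
  have h1 : Tendsto (fun t => ∫ s in (0 : ℝ)..t, Real.sin (η * s) * g s) (𝓝[>] 0) (𝓝 0) := by
    have hI : IntegrableOn (fun s => Real.sin (η * s) * g s) (Set.uIcc 0 1) := by
      rw [Set.uIcc_of_le zero_le_one, integrableOn_Icc_iff_integrableOn_Ioc]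
      exact (integrableOn_sin_mul hint η).mono_set Set.Ioc_subset_Ioi_self
    have := intervalIntegral.continuousOn_primitive_interval hI 0 (by simp)
    rw [Set.uIcc_of_le zero_le_one] at this
    have h' : Tendsto (fun t => ∫ s in (0 : ℝ)..t, Real.sin (η * s) * g s)
      (𝓝[Set.Icc 0 1] 0) (𝓝 (∫ s in (0 : ℝ)..0, Real.sin (η * s) * g s)) := this
    rw [intervalIntegral.integral_same] at h'
    refine h'.mono_left ?_
    rw [← nhdsWithin_Ioc_eq_nhdsGT (zero_lt_one' ℝ)]
    exact nhdsWithin_mono _ Set.Ioc_subset_Icc_self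
  have h2 : Tendsto (fun t => (1 - Real.cos (η * t)) * g t) (𝓝[>] 0) (𝓝 0) := by
    set C := ∫ s in Set.Ioi 0, g s
    have h3 : Tendsto (fun t : ℝ => η ^ 2 / 2 * C * t) (𝓝[>] 0) (𝓝 0) := by
      have : Tendsto (fun t : ℝ => η ^ 2 / 2 * C * t) (𝓝 0) (𝓝 (η ^ 2 / 2 * C * 0)) :=
        (continuous_const.mul continuous_id).tendsto 0
      rw [mul_zero] at this
      exact this.mono_left nhdsWithin_le_nhds
    refine squeeze_zero' ?_ ?_ h3
    · filter_upwards [self_mem_nhdsWithin] with t ht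
      exact mul_nonneg (by linarith [Real.cos_le_one (η * t)]) (hpos t ht)
    · filter_upwards [self_mem_nhdsWithin] with t ht
      have ht : 0 < t := ht
      have hc : 1 - Real.cos (η * t) ≤ (η * t) ^ 2 / 2 := by
        linarith [Real.one_sub_sq_div_two_le_cos (x := η * t)]
      have hg := mul_le_setIntegral_of_antitoneOn hanti hpos hint ht
      calc (1 - Real.cos (η * t)) * g t ≤ (η * t) ^ 2 / 2 * g t :=
            mul_le_mul_of_nonneg_right hc (hpos t ht)
        _ = η ^ 2 / 2 * t * (t * g t) := by ring
        _ ≤ η ^ 2 / 2 * t * C := by gcongr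
        _ = _ := by ring
  have := (h1.const_mul η).sub h2
  rw [mul_zero, sub_zero] at this
  exact this

include hderiv hnonpos hpos hint in
lemma tendsto_sinPrimitive_atTop : Tendsto (sinPrimitive g η) atTop
    (𝓝 (η * ∫ s in Set.Ioi 0, Real.sin (η * s) * g s)) := by
  have hanti := antitoneOn_of_hasDerivAt_nonpos hderiv hnonpos
  have h1 : Tendsto (fun t => ∫ s in (0 : ℝ)..t, Real.sin (η * s) * g s) atTop
      (𝓝 (∫ s in Set.Ioi 0, Real.sin (η * s) * g s)) :=
    intervalIntegral_tendsto_integral_Ioi 0 (integrableOn_sin_mul hint η) tendsto_id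
  have h2 : Tendsto (fun t => (1 - Real.cos (η * t)) * g t) atTop (𝓝 0) := by
    set C := ∫ s in Set.Ioi 0, g s
    have h3 : Tendsto (fun t : ℝ => 2 * C / t) atTop (𝓝 0) :=
      tendsto_const_nhds.div_atTop tendsto_id
    refine squeeze_zero' ?_ ?_ h3
    · filter_upwards [eventually_gt_atTop 0] with t ht
      exact mul_nonneg (by linarith [Real.cos_le_one (η * t)]) (hpos t ht)
    · filter_upwards [eventually_gt_atTop 0] with t ht
      have hg := mul_le_setIntegral_of_antitoneOn hanti hpos hint ht
      rw [le_div_iff₀ ht]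
      calc (1 - Real.cos (η * t)) * g t * t = (1 - Real.cos (η * t)) * (t * g t) := by ring
        _ ≤ 2 * (t * g t) := by
            refine mul_le_mul_of_nonneg_right (by linarith [Real.neg_one_le_cos (η * t)]) ?_
            exact mul_nonneg ht.le (hpos t ht)
        _ ≤ 2 * C := by gcongr
  have := (h1.const_mul η).sub h2
  rw [sub_zero] at this
  exact this

include hderiv hnonpos hpos hint in
lemma sinPrimitive_mem_Icc {t : ℝ} (ht : 0 < t) : sinPrimitive g η t ∈
    Set.Icc 0 (η * ∫ s in Set.Ioi 0, Real.sin (η * s) * g s) := by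
  have hmono := monotoneOn_sinPrimitive hderiv hnonpos hint η
  constructor
  · refine le_of_tendsto (tendsto_sinPrimitive_zero hderiv hnonpos hpos hint η) ?_
    filter_upwards [Ioo_mem_nhdsGT ht] with s hs using hmono hs.1 ht hs.2.le
  · refine ge_of_tendsto (tendsto_sinPrimitive_atTop hderiv hnonpos hpos hint η) ?_
    filter_upwards [eventually_ge_atTop t] with s hs using hmono ht (ht.trans_le hs) hs

include hderiv hnonpos hpos hint in
/-- A decreasing nonnegative integrable function has a sine transform of the sign of `η`. -/
lemma mul_integral_sin_nonneg : 0 ≤ η * ∫ s in Set.Ioi 0, Real.sin (η * s) * g s :=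
  let h := sinPrimitive_mem_Icc hderiv hnonpos hpos hint η one_pos
  h.1.trans h.2

include hderiv hnonpos hpos hint in
/-- If moreover `g` is convex, its sine transform vanishes at a frequency `η ≠ 0` only if `g`
vanishes: otherwise `sinPrimitive g η` is constant, so `g'` vanishes near `0` and, being
increasing and nonpositive, everywhere. -/
lemma eq_zero_of_integral_sin_eq_zero (hmono : MonotoneOn g' (Set.Ioi 0)) (hη : η ≠ 0)
    (h0 : ∫ s in Set.Ioi 0, Real.sin (η * s) * g s = 0) {t : ℝ} (ht : 0 < t) : g t = 0 := by
  have hK : ∀ t, 0 < t → sinPrimitive g η t = 0 := fun t ht => by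
    have := sinPrimitive_mem_Icc hderiv hnonpos hpos hint η ht
    rw [h0, mul_zero] at this
    exact le_antisymm this.2 this.1
  have hg' : ∀ t, 0 < t → g' t = 0 := by
    intro t ht
    set s := min t (Real.pi / |η|)
    have hηpos : 0 < |η| := abs_pos.2 hη
    have hs : 0 < s := lt_min ht (div_pos Real.pi_pos hηpos)
    have hd : -((1 - Real.cos (η * s)) * g' s) = 0 := by
      refine (hasDerivAt_sinPrimitive hderiv hint η hs).unique ?_
      refine (hasDerivAt_const s (0 : ℝ)).congr_of_eventuallyEq ?_
      filter_upwards [Ioi_mem_nhds hs] with x hx using hK x hx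
    have hcos : Real.cos (η * s) < 1 := by
      have h1 : 0 < |η * s| := by positivity
      have h2 : |η * s| ≤ Real.pi := by
        rw [abs_mul, abs_of_pos hs]
        calc |η| * s ≤ |η| * (Real.pi / |η|) := by gcongr; exact min_le_right _ _
          _ = Real.pi := by field_simp
      rw [← Real.cos_abs, ← Real.cos_zero]
      exact Real.cos_lt_cos_of_nonneg_of_le_pi le_rfl h2 h1
    have hs0 : g' s = 0 := by
      rcases mul_eq_zero.1 (neg_eq_zero.1 hd) with h | h
      · linarith
      · exact h
    exact le_antisymm (hnonpos t ht) (hs0 ▸ hmono hs ht (min_le_left _ _))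
  by_contra hne
  have hgt : 0 < g t := lt_of_le_of_ne (hpos t ht) (Ne.symm hne)
  have hanti := antitoneOn_of_hasDerivAt_nonpos hderiv hnonpos
  have hmono' : AntitoneOn (fun t => -g t) (Set.Ioi 0) :=
    antitoneOn_of_hasDerivAt_nonpos (g' := fun t => -g' t) (fun t ht => (hderiv t ht).neg)
      (fun t ht => by simp [hg' t ht])
  -- `g` is a positive constant, which is not integrable
  set C := ∫ s in Set.Ioi 0, g s
  set x := max t ((C + 1) / g t)
  have hx : 0 < x := lt_max_of_lt_left ht
  have h1 := mul_le_setIntegral_of_antitoneOn hanti hpos hint hx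
  have h2 : g t ≤ g x := by
    have := hmono' ht hx (le_max_left _ _)
    simpa using this
  have h3 : C + 1 ≤ x * g t := by
    rw [← div_le_iff₀ hgt]; exact le_max_right _ _
  nlinarith

end

/-! ### Completely monotonic functions -/

namespace IsCompletelyMonotonic

variable {f : ℝ → ℝ}

lemma contDiffOn_deriv_iterate (hf : IsCompletelyMonotonic f) (m : ℕ) :
    ContDiffOn ℝ ∞ (deriv^[m] f) (Set.Ioi 0) := by
  induction m with
  | zero => exact hf.1
  | succ m ih =>
    rw [Function.iterate_succ_apply']
    exact ((contDiffOn_infty_iff_deriv_of_isOpen isOpen_Ioi).1 ih).2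

lemma hasDerivAt_deriv_iterate (hf : IsCompletelyMonotonic f) (m : ℕ) {t : ℝ} (ht : 0 < t) :
    HasDerivAt (deriv^[m] f) (deriv^[m + 1] f t) t := by
  rw [Function.iterate_succ_apply']
  exact (((hf.contDiffOn_deriv_iterate m).contDiffAt (Ioi_mem_nhds ht)).differentiableAt
    (by simp)).hasDerivAt

lemma nonneg_deriv_iterate (hf : IsCompletelyMonotonic f) (m : ℕ) {t : ℝ} (ht : 0 < t) :
    0 ≤ (-1) ^ m * deriv^[m] f t := by
  have := hf.2 m t ht
  rwa [iteratedDerivWithin_of_isOpen isOpen_Ioi ht, iteratedDeriv_eq_iterate] at this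

lemma hasDerivAt (hf : IsCompletelyMonotonic f) {t : ℝ} (ht : 0 < t) :
    HasDerivAt f (deriv f t) t := hf.hasDerivAt_deriv_iterate 0 ht

lemma hasDerivAt_deriv (hf : IsCompletelyMonotonic f) {t : ℝ} (ht : 0 < t) :
    HasDerivAt (deriv f) (deriv (deriv f) t) t := hf.hasDerivAt_deriv_iterate 1 ht

lemma deriv_nonpos (hf : IsCompletelyMonotonic f) {t : ℝ} (ht : 0 < t) : deriv f t ≤ 0 := by
  simpa using hf.nonneg_deriv_iterate 1 ht

lemma deriv_deriv_nonneg (hf : IsCompletelyMonotonic f) {t : ℝ} (ht : 0 < t) :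
    0 ≤ deriv (deriv f) t := by
  simpa using hf.nonneg_deriv_iterate 2 ht

lemma antitoneOn_deriv_deriv (hf : IsCompletelyMonotonic f) :
    AntitoneOn (deriv (deriv f)) (Set.Ioi 0) := by
  refine antitoneOn_of_hasDerivAt_nonpos (g' := deriv^[3] f)
    (fun t ht => hf.hasDerivAt_deriv_iterate 2 ht) fun t ht => ?_
  have := hf.nonneg_deriv_iterate 3 ht
  norm_num at this
  exact this

end IsCompletelyMonotonic

/-- Changing the value of `f` at `0` into its right limit there makes it continuous up to `0`. -/
lemma continuousWithinAt_update {E : Type*} [TopologicalSpace E] {f : ℝ → E} {a : E}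
    (h0 : Tendsto f (𝓝[>] 0) (𝓝 a)) :
    ContinuousWithinAt (Function.update f 0 a) (Set.Ici 0) 0 := by
  rw [← continuousWithinAt_sdiff_self]
  have : Set.Ici (0 : ℝ) \ {0} = Set.Ioi 0 := by
    ext x; simp [lt_iff_le_and_ne, eq_comm]
  rw [this, ContinuousWithinAt, Function.update_self]
  refine h0.congr' ?_
  filter_upwards [self_mem_nhdsWithin] with x hx
  rw [Function.update_of_ne (ne_of_gt hx)]

lemma hasDerivAt_update {E : Type*} [NormedAddCommGroup E] [NormedSpace ℝ E] {f : ℝ → E}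
    {a f' : E} {t : ℝ} (ht : 0 < t) (h : HasDerivAt f f' t) :
    HasDerivAt (Function.update f 0 a) f' t := by
  refine h.congr_of_eventuallyEq ?_
  filter_upwards [Ioi_mem_nhds ht] with x hx
  rw [Function.update_of_ne (ne_of_gt hx)]

lemma tendsto_update_atTop {E : Type*} [TopologicalSpace E] {f : ℝ → E} {a b : E}
    (h : Tendsto f atTop (𝓝 b)) : Tendsto (Function.update f 0 a) atTop (𝓝 b) := by
  refine h.congr' ?_
  filter_upwards [eventually_gt_atTop 0] with x hx
  rw [Function.update_of_ne (ne_of_gt hx)]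

/-! ### Laplace transforms of functions with integrable derivative -/

/-- The value at `p` of `p` times the Laplace transform of a function with right limit `a` at `0`
and derivative `f'`, after an integration by parts. Unlike the Laplace integral it makes sense on
the imaginary axis. -/
noncomputable def laplaceStieltjes (a : ℝ) (f' : ℝ → ℝ) (p : ℂ) : ℂ :=
  a + ∫ t in Set.Ioi (0 : ℝ), Complex.exp (-p * (t : ℂ)) * (f' t : ℂ)

lemma norm_exp_neg_mul_le {p : ℂ} (hp : 0 ≤ p.re) {t : ℝ} (ht : 0 < t) :
    ‖Complex.exp (-p * (t : ℂ))‖ ≤ 1 := by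
  rw [Complex.norm_exp]
  simpa using mul_nonneg hp ht.le

lemma integrableOn_exp_mul {f' : ℝ → ℝ} (hint : IntegrableOn f' (Set.Ioi 0)) {p : ℂ}
    (hp : 0 ≤ p.re) :
    IntegrableOn (fun t : ℝ => Complex.exp (-p * (t : ℂ)) * (f' t : ℂ)) (Set.Ioi 0) := by
  refine Integrable.bdd_mul (c := 1) hint.ofReal ?_ ?_
  · exact (by fun_prop : Continuous fun t : ℝ => Complex.exp (-p * (t : ℂ))).aestronglyMeasurable
  · filter_upwards [ae_restrict_mem measurableSet_Ioi] with t ht using norm_exp_neg_mul_le hp ht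

lemma continuousWithinAt_laplaceStieltjes (a : ℝ) {f' : ℝ → ℝ}
    (hint : IntegrableOn f' (Set.Ioi 0)) (p : ℂ) :
    ContinuousWithinAt (laplaceStieltjes a f') {z : ℂ | 0 < z.re} p := by
  refine continuousWithinAt_const.add ?_
  refine continuousWithinAt_of_dominated (bound := fun t => ‖f' t‖) ?_ ?_ hint.norm ?_
  · filter_upwards [self_mem_nhdsWithin] with q hq
    exact (integrableOn_exp_mul hint (le_of_lt hq)).aestronglyMeasurable
  · filter_upwards [self_mem_nhdsWithin] with q hq
    filter_upwards [ae_restrict_mem measurableSet_Ioi] with t ht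
    rw [norm_mul, Complex.norm_real]
    exact mul_le_of_le_one_left (norm_nonneg _) (norm_exp_neg_mul_le (le_of_lt hq) ht)
  · refine Eventually.of_forall fun t => ?_
    exact (by fun_prop : Continuous fun q : ℂ =>
      Complex.exp (-q * (t : ℂ)) * (f' t : ℂ)).continuousWithinAt

section

variable {f f' : ℝ → ℝ} {a b : ℝ} (hderiv : ∀ t, 0 < t → HasDerivAt f (f' t) t)
  (hint : IntegrableOn f' (Set.Ioi 0)) (h0 : Tendsto f (𝓝[>] 0) (𝓝 a))
  (hinf : Tendsto f atTop (𝓝 b))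

include hderiv h0 hinf in
lemma exists_bound_of_limits : ∃ C, ∀ t, 0 < t → |f t| ≤ C := by
  obtain ⟨ε, hε, h1⟩ := mem_nhdsGT_iff_exists_Ioo_subset.1
    (h0.abs.eventually (gt_mem_nhds (lt_add_one |a|)))
  obtain ⟨T, hT⟩ := eventually_atTop.1 (hinf.abs.eventually (gt_mem_nhds (lt_add_one |b|)))
  have hε : 0 < ε := hε
  have hc : ContinuousOn f (Set.Icc ε T) := fun t ht =>
    (hderiv t (hε.trans_le ht.1)).continuousAt.continuousWithinAt
  obtain ⟨C, hC⟩ := isCompact_Icc.exists_bound_of_continuousOn hc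
  refine ⟨max C (max (|a| + 1) (|b| + 1)), fun t ht => ?_⟩
  rcases lt_or_ge t ε with h | h
  · exact (h1 ⟨ht, h⟩ : |f t| < |a| + 1).le.trans ((le_max_left _ _).trans (le_max_right _ _))
  rcases le_or_gt T t with h' | h'
  · exact (hT t h').le.trans ((le_max_right _ _).trans (le_max_right _ _))
  · exact (hC t ⟨h, h'.le⟩).trans (le_max_left _ _)

include hderiv hint h0 hinf in
lemma mul_laplace_eq_laplaceStieltjes {p : ℂ} (hp : 0 < p.re) :
    p * ∫ t in Set.Ioi (0 : ℝ), Complex.exp (-p * (t : ℂ)) * (f t : ℂ) =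
      laplaceStieltjes a f' p := by
  obtain ⟨C, hC⟩ := exists_bound_of_limits hderiv h0 hinf
  have hexp : IntegrableOn (fun t : ℝ => Complex.exp (-p * (t : ℂ))) (Set.Ioi 0) :=
    integrableOn_exp_mul_complex_Ioi (by simpa using hp) 0
  have hf : IntegrableOn (fun t : ℝ => Complex.exp (-p * (t : ℂ)) * (f t : ℂ)) (Set.Ioi 0) := by
    refine Integrable.mul_bdd (c := C) hexp ?_ ?_
    · refine ContinuousOn.aestronglyMeasurable (fun t ht => ?_) measurableSet_Ioi
      exact (Complex.continuous_ofReal.continuousAt.comp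
        (hderiv t ht).continuousAt).continuousWithinAt
    · filter_upwards [ae_restrict_mem measurableSet_Ioi] with t ht
      simpa using hC t ht
  have hf' := integrableOn_exp_mul hint hp.le
  have hd : ∀ t : ℝ, 0 < t → HasDerivAt (fun t : ℝ => Complex.exp (-p * (t : ℂ)) * (f t : ℂ))
      (Complex.exp (-p * (t : ℂ)) * (f' t : ℂ) -
        p * (Complex.exp (-p * (t : ℂ)) * (f t : ℂ))) t := by
    intro t ht
    have h1 : HasDerivAt (fun t : ℝ => Complex.exp (-p * (t : ℂ)))
        (Complex.exp (-p * (t : ℂ)) * (-p * 1)) t :=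
      (Complex.ofRealCLM.hasDerivAt.const_mul (-p)).cexp
    refine (h1.mul (hderiv t ht).ofReal_comp).congr_deriv ?_
    ring
  have hlim0 : Tendsto (fun t : ℝ => Complex.exp (-p * (t : ℂ)) * (f t : ℂ)) (𝓝[>] 0)
      (𝓝 (a : ℂ)) := by
    have h1 : Tendsto (fun t : ℝ => Complex.exp (-p * (t : ℂ))) (𝓝[>] 0) (𝓝 1) := by
      have := (by fun_prop : Continuous fun t : ℝ => Complex.exp (-p * (t : ℂ))).tendsto 0
      simp only [Complex.ofReal_zero, mul_zero, Complex.exp_zero] at this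
      exact this.mono_left nhdsWithin_le_nhds
    simpa using h1.mul ((Complex.continuous_ofReal.tendsto a).comp h0)
  have hlim : Tendsto (fun t : ℝ => Complex.exp (-p * (t : ℂ)) * (f t : ℂ)) atTop (𝓝 0) := by
    have h1 : Tendsto (fun t : ℝ => Complex.exp (-p * (t : ℂ))) atTop (𝓝 0) := by
      rw [tendsto_zero_iff_norm_tendsto_zero]
      simp only [Complex.norm_exp]
      refine Real.tendsto_exp_atBot.comp ?_
      have : (fun t : ℝ => (-p * (t : ℂ)).re) = fun t => -(p.re * t) := by ext; simp
      rw [this]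
      exact tendsto_neg_atTop_atBot.comp (tendsto_id.const_mul_atTop hp)
    simpa using h1.mul ((Complex.continuous_ofReal.tendsto b).comp hinf)
  have key := integral_Ioi_of_hasDerivAt_of_tendsto (continuousWithinAt_update hlim0)
    (fun t ht => hasDerivAt_update ht (hd t ht)) (hf'.sub (hf.const_mul p))
    (tendsto_update_atTop hlim)
  rw [Function.update_self, integral_sub hf' (hf.const_mul p), integral_const_mul] at key
  rw [laplaceStieltjes]
  linear_combination -key

end

section

variable {f : ℝ → ℝ} {a b : ℝ} (hf : IsCompletelyMonotonic f)
  (h0 : Tendsto f (𝓝[>] 0) (𝓝 a)) (hinf : Tendsto f atTop (𝓝 b))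

include hf h0 hinf in
lemma IsCompletelyMonotonic.integrableOn_deriv : IntegrableOn (deriv f) (Set.Ioi 0) :=
  integrableOn_Ioi_deriv_of_nonpos (continuousWithinAt_update h0)
    (fun _ ht => hasDerivAt_update ht (hf.hasDerivAt ht)) (fun _ ht => hf.deriv_nonpos ht)
    (tendsto_update_atTop hinf)

include hf h0 hinf in
lemma IsCompletelyMonotonic.integral_deriv : ∫ t in Set.Ioi 0, deriv f t = b - a := by
  have := integral_Ioi_of_hasDerivAt_of_nonpos (continuousWithinAt_update h0)
    (fun _ ht => hasDerivAt_update ht (hf.hasDerivAt ht)) (fun _ ht => hf.deriv_nonpos ht)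
    (tendsto_update_atTop hinf)
  rwa [Function.update_self] at this

include hf h0 hinf in
/-- The real part is at least the limit of `f` at infinity, because
`‖∫ exp (-p t) f' t‖ ≤ ∫ |f'| = a - b`. -/
lemma IsCompletelyMonotonic.le_re_laplaceStieltjes {p : ℂ} (hp : 0 ≤ p.re) :
    b ≤ (laplaceStieltjes a (deriv f) p).re := by
  have hint := hf.integrableOn_deriv h0 hinf
  have h1 : ‖∫ t in Set.Ioi (0 : ℝ),
      Complex.exp (-p * (t : ℂ)) * ((deriv f t : ℝ) : ℂ)‖ ≤ a - b := by
    calc _ ≤ ∫ t in Set.Ioi (0 : ℝ), -deriv f t := by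
          refine norm_integral_le_of_norm_le hint.neg ?_
          filter_upwards [ae_restrict_mem measurableSet_Ioi] with t ht
          rw [norm_mul, Complex.norm_real, Real.norm_of_nonpos (hf.deriv_nonpos ht)]
          exact mul_le_of_le_one_left (neg_nonneg.2 (hf.deriv_nonpos ht))
            (norm_exp_neg_mul_le hp ht)
      _ = a - b := by rw [integral_neg, hf.integral_deriv h0 hinf]; ring
  have h2 := (abs_le.1 ((Complex.abs_re_le_norm _).trans h1)).1
  simp only [laplaceStieltjes, Complex.add_re, Complex.ofReal_re]
  linarith

lemma im_laplaceStieltjes (a : ℝ) {f' : ℝ → ℝ} (hint : IntegrableOn f' (Set.Ioi 0)) {p : ℂ}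
    (hp : 0 ≤ p.re) : (laplaceStieltjes a f' p).im =
      ∫ t in Set.Ioi (0 : ℝ), Real.sin (p.im * t) * (Real.exp (-p.re * t) * -f' t) := by
  simp only [laplaceStieltjes, Complex.add_im, Complex.ofReal_im, zero_add]
  have := integral_im (𝕜 := ℂ) (integrableOn_exp_mul hint hp)
  simp only [RCLike.im_to_complex] at this
  rw [← this]
  refine setIntegral_congr_fun measurableSet_Ioi fun t _ => ?_
  simp [Complex.exp_im, Complex.exp_re]
  ring

lemma integrableOn_exp_mul_real {f' : ℝ → ℝ} (hint : IntegrableOn f' (Set.Ioi 0)) {r : ℝ}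
    (hr : 0 ≤ r) : IntegrableOn (fun t => Real.exp (-r * t) * -f' t) (Set.Ioi 0) := by
  refine Integrable.bdd_mul (c := 1) hint.neg ?_ ?_
  · exact (by fun_prop : Continuous fun t : ℝ => Real.exp (-r * t)).aestronglyMeasurable
  · filter_upwards [ae_restrict_mem measurableSet_Ioi] with t ht
    have : 0 ≤ r * t := mul_nonneg hr (le_of_lt ht)
    simpa using this

include hf in
lemma IsCompletelyMonotonic.hasDerivAt_exp_mul (r : ℝ) {t : ℝ} (ht : 0 < t) :
    HasDerivAt (fun t => Real.exp (-r * t) * -deriv f t)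
      (Real.exp (-r * t) * (r * deriv f t - deriv (deriv f) t)) t := by
  have h1 : HasDerivAt (fun t : ℝ => Real.exp (-r * t)) (Real.exp (-r * t) * (-r * 1)) t :=
    ((hasDerivAt_id t).const_mul (-r)).exp
  refine (h1.mul (hf.hasDerivAt_deriv ht).neg).congr_deriv ?_
  simp only [Pi.neg_apply]
  ring

include hf h0 hinf in
lemma IsCompletelyMonotonic.im_mul_im_laplaceStieltjes_nonneg {p : ℂ} (hp : 0 ≤ p.re) :
    0 ≤ p.im * (laplaceStieltjes a (deriv f) p).im := by
  have hint := hf.integrableOn_deriv h0 hinf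
  rw [im_laplaceStieltjes a hint hp]
  refine mul_integral_sin_nonneg (fun t ht => hf.hasDerivAt_exp_mul p.re ht) (fun t ht => ?_)
    (fun t ht => ?_) (integrableOn_exp_mul_real hint hp) p.im
  · refine mul_nonpos_of_nonneg_of_nonpos (Real.exp_pos _).le ?_
    nlinarith [hf.deriv_nonpos ht, hf.deriv_deriv_nonneg ht]
  · exact mul_nonneg (Real.exp_pos _).le (neg_nonneg.2 (hf.deriv_nonpos ht))

include hf h0 hinf in
/-- On the punctured imaginary axis the imaginary part vanishes only for constant `f`. -/
lemma IsCompletelyMonotonic.deriv_eq_zero_of_im_laplaceStieltjes_eq_zero {p : ℂ}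
    (hp : p.re = 0) (hpi : p.im ≠ 0) (him : (laplaceStieltjes a (deriv f) p).im = 0)
    {t : ℝ} (ht : 0 < t) : deriv f t = 0 := by
  have hint := hf.integrableOn_deriv h0 hinf
  rw [im_laplaceStieltjes a hint hp.ge] at him
  simp only [hp, neg_zero, zero_mul, Real.exp_zero, one_mul] at him
  refine neg_eq_zero.1 (eq_zero_of_integral_sin_eq_zero
    (fun t ht => (hf.hasDerivAt_deriv ht).neg)
    (fun t ht => neg_nonpos.2 (hf.deriv_deriv_nonneg ht))
    (fun t ht => neg_nonneg.2 (hf.deriv_nonpos ht)) hint.neg p.im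
    (fun x hx y hy hxy => neg_le_neg (hf.antitoneOn_deriv_deriv hx hy hxy)) hpi him ht)

end

/-! ### Principal square roots of accretive matrices -/

/-- The square root of `1 - X` for `‖X‖ < 1` in a Banach algebra, as `1 - Z` where `Z` is the
fixed point of the contraction `Z ↦ (X + Z²) / 2` of a ball of radius less than one. -/
lemma exists_sq_one_sub_eq {A : Type*} [NormedRing A] [NormedAlgebra ℂ A] [CompleteSpace A]
    {X : A} (hX : ‖X‖ < 1) : ∃ Z : A, ‖Z‖ < 1 ∧ (1 - Z) * (1 - Z) = 1 - X := by
  -- `r = 1 - √(1 - ‖X‖)` solves `(‖X‖ + r²) / 2 = r`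
  set s := Real.sqrt (1 - ‖X‖)
  have hs0 : 0 < s := Real.sqrt_pos.2 (by linarith)
  have hs2 : s * s = 1 - ‖X‖ := Real.mul_self_sqrt (by linarith)
  have hs1 : s ≤ 1 := Real.sqrt_le_one.2 (by linarith [norm_nonneg X])
  have hr0 : 0 ≤ 1 - s := by linarith
  let φ : A → A := fun Z => (2⁻¹ : ℂ) • (X + Z * Z)
  have hmaps : Set.MapsTo φ (Metric.closedBall 0 (1 - s)) (Metric.closedBall 0 (1 - s)) := by
    intro Z hZ
    rw [mem_closedBall_zero_iff] at hZ ⊢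
    have h1 : ‖φ Z‖ ≤ 2⁻¹ * (‖X‖ + ‖Z‖ * ‖Z‖) := by
      calc ‖φ Z‖ = 2⁻¹ * ‖X + Z * Z‖ := by rw [norm_smul]; norm_num
        _ ≤ _ := by
          gcongr
          exact (norm_add_le _ _).trans (by gcongr; exact norm_mul_le _ _)
    nlinarith [norm_nonneg Z]
  have hlip : LipschitzOnWith (1 - s).toNNReal φ (Metric.closedBall 0 (1 - s)) := by
    refine LipschitzOnWith.of_dist_le_mul fun Z hZ W hW => ?_
    rw [mem_closedBall_zero_iff] at hZ hW
    rw [Real.coe_toNNReal _ hr0, dist_eq_norm, dist_eq_norm]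
    have h1 : φ Z - φ W = (2⁻¹ : ℂ) • ((Z - W) * Z + W * (Z - W)) := by
      simp only [φ, ← smul_sub]; congr 1; noncomm_ring
    calc ‖φ Z - φ W‖ = 2⁻¹ * ‖(Z - W) * Z + W * (Z - W)‖ := by rw [h1, norm_smul]; norm_num
      _ ≤ 2⁻¹ * (‖Z - W‖ * (1 - s) + (1 - s) * ‖Z - W‖) := by
          gcongr
          refine (norm_add_le _ _).trans (add_le_add ?_ ?_)
          · exact (norm_mul_le _ _).trans (by gcongr)
          · exact (norm_mul_le _ _).trans (by gcongr)
      _ = _ := by ring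
  have hcontr : ContractingWith (1 - s).toNNReal
      (hmaps.restrict φ (Metric.closedBall 0 (1 - s)) (Metric.closedBall 0 (1 - s))) := by
    refine ⟨?_, ?_⟩
    · rw [Real.toNNReal_lt_one]; linarith
    · exact hlip.mapsToRestrict hmaps
  obtain ⟨Z, hZ, hfix, -⟩ := ContractingWith.exists_fixedPoint'
    Metric.isClosed_closedBall.isComplete hmaps hcontr (x := 0) (by simpa using hr0) (edist_ne_top _ _)
  rw [mem_closedBall_zero_iff] at hZ
  refine ⟨Z, by linarith, ?_⟩
  have h2 : (2⁻¹ : ℂ) • (X + Z * Z) = Z := hfix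
  have h3 : X + Z * Z = (2 : ℂ) • Z := by rw [← h2, smul_smul, h2]; simp
  have h4 : X = Z + Z - Z * Z := by rw [eq_sub_iff_add_eq, h3, two_smul]
  rw [h4]; noncomm_ring

section

open scoped Matrix.Norms.L2Operator

variable {d : ℕ} {B : Matrix (Fin d) (Fin d) ℂ}

lemma exists_isPrincipalSqrt_of_norm_lt {ε : ℝ} (hε : 0 < ε) (h : ‖1 - (ε : ℂ) • B‖ < 1) :
    ∃ Y, IsPrincipalSqrt B Y := by
  obtain ⟨Z, hZ, hZX⟩ := exists_sq_one_sub_eq h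
  rw [sub_sub_cancel] at hZX
  set c := Real.sqrt ε
  have hc : 0 < c := Real.sqrt_pos.2 hε
  have hcc : (c : ℂ) * c = ε := by exact_mod_cast Real.mul_self_sqrt hε.le
  have hc0 : (c : ℂ) ≠ 0 := by exact_mod_cast hc.ne'
  refine ⟨(c : ℂ)⁻¹ • (1 - Z), ?_, ?_⟩
  · rw [smul_mul_smul_comm, hZX, smul_smul, ← hcc]
    rw [show (c : ℂ)⁻¹ * (c : ℂ)⁻¹ * (c * c) = 1 by field_simp, one_smul]
  · intro z hz
    have hz2 : 1 - c * z ∈ spectrum ℂ Z := by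
      rw [spectrum.mem_iff] at hz ⊢
      intro hu
      apply hz
      have hu2 : IsUnit ((algebraMap ℂ (Matrix (Fin d) (Fin d) ℂ)) (-(c : ℂ)⁻¹) *
          (algebraMap ℂ _ (1 - c * z) - Z)) :=
        IsUnit.mul (IsUnit.map _ (by simpa using hc0)) hu
      convert hu2 using 1
      simp only [Algebra.algebraMap_eq_smul_one, smul_one_mul, smul_sub, smul_smul, sub_smul]
      rw [show -(c : ℂ)⁻¹ * (c * z) = -z by field_simp]
      module
    have h1 : ‖(1 - c * z : ℂ)‖ < 1 := by
      rcases subsingleton_or_nontrivial (Matrix (Fin d) (Fin d) ℂ) with _ | _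
      · simp at hz2
      · exact (spectrum.norm_le_norm_of_mem hz2).trans_lt hZ
    have h2 := (Complex.abs_re_le_norm _).trans_lt h1
    have h3 : (1 - c * z : ℂ).re = 1 - c * z.re := by simp
    rw [h3] at h2
    have := (abs_lt.1 h2).2
    nlinarith

lemma norm_one_sub_smul_lt_one (hB : ∀ v : Fin d → ℂ, v ≠ 0 → 0 < (star v ⬝ᵥ B *ᵥ v).re) :
    ∃ ε : ℝ, 0 < ε ∧ ‖1 - (ε : ℂ) • B‖ < 1 := by
  let T := Matrix.toEuclideanCLM (n := Fin d) (𝕜 := ℂ) B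
  have hT : ∀ x : EuclideanSpace ℂ (Fin d), x ≠ 0 → 0 < (inner ℂ x (T x)).re := by
    intro x hx
    have := hB x.ofLp (by simpa using hx)
    rw [dotProduct_comm] at this
    exact this
  -- the numerical range over the unit sphere is bounded below by some `m > 0`
  obtain ⟨m, hm, hTm⟩ : ∃ m > 0, ∀ x : EuclideanSpace ℂ (Fin d),
      m * ‖x‖ ^ 2 ≤ (inner ℂ x (T x)).re := by
    have hcont : Continuous fun x : EuclideanSpace ℂ (Fin d) => (inner ℂ x (T x)).re := by
      fun_prop
    rcases (Metric.sphere (0 : EuclideanSpace ℂ (Fin d)) 1).eq_empty_or_nonempty with he | hne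
    · refine ⟨1, one_pos, fun x => ?_⟩
      have : x = 0 := by
        by_contra hx
        have : ((‖x‖⁻¹ : ℝ) : ℂ) • x ∈ Metric.sphere (0 : EuclideanSpace ℂ (Fin d)) 1 := by
          have := norm_ne_zero_iff.2 hx
          simp [norm_smul, this]
        rw [he] at this
        exact this
      simp [this]
    · obtain ⟨x₀, hx₀, hmin⟩ := (isCompact_sphere _ _).exists_isMinOn hne hcont.continuousOn
      rw [mem_sphere_zero_iff_norm] at hx₀
      refine ⟨_, hT x₀ (by rintro rfl; simp at hx₀), fun x => ?_⟩
      rcases eq_or_ne x 0 with rfl | hx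
      · simp
      have hn := norm_ne_zero_iff.2 hx
      have hmem : ((‖x‖⁻¹ : ℝ) : ℂ) • x ∈ Metric.sphere (0 : EuclideanSpace ℂ (Fin d)) 1 := by
        simp [norm_smul, hn]
      have h1 := hmin hmem
      simp only [Set.mem_ofPred_eq, map_smul, inner_smul_left, inner_smul_right,
        Complex.conj_ofReal, Complex.re_ofReal_mul] at h1
      calc _ ≤ (‖x‖⁻¹ * (‖x‖⁻¹ * (inner ℂ x (T x)).re)) * ‖x‖ ^ 2 := by gcongr
        _ = _ := by field_simp
  -- `‖x - ε T x‖² ≤ (1 - 2 ε m + ε² ‖T‖²) ‖x‖²`, and `ε = m / (‖T‖² + m²)` keeps this below one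
  set M := ‖T‖ ^ 2 + m ^ 2
  have hM : 0 < M := by positivity
  refine ⟨m / M, by positivity, ?_⟩
  set ε := m / M
  have hε : 0 < ε := by positivity
  have hεM : ε * M = m := by simp only [ε]; field_simp
  set q := 1 - ε * m
  have hq1 : q < 1 := by simp only [q]; nlinarith [mul_pos hε hm]
  have hq0 : 0 ≤ q := by
    simp only [q, ε]
    rw [sub_nonneg, div_mul_eq_mul_div, div_le_one hM]
    simp only [M]; nlinarith [sq_nonneg ‖T‖]
  rw [← Matrix.l2_opNorm_toEuclideanCLM]
  refine (ContinuousLinearMap.opNorm_le_bound _ (Real.sqrt_nonneg q) fun x => ?_).trans_lt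
    (by rw [Real.sqrt_lt' one_pos]; simpa using hq1)
  have hx : (Matrix.toEuclideanCLM (n := Fin d) (𝕜 := ℂ) (1 - (ε : ℂ) • B)) x =
      x - (ε : ℂ) • T x := by
    rw [map_sub, map_one, map_smul]
    rfl
  rw [hx]
  refine abs_le_of_sq_le_sq' ?_ (by positivity) |>.2
  rw [mul_pow, Real.sq_sqrt hq0, @norm_sub_sq ℂ, inner_smul_right, norm_smul]
  simp only [RCLike.re_to_complex, Complex.re_ofReal_mul, Complex.norm_real, Real.norm_eq_abs,
    abs_of_pos hε]
  have h1 := hTm x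
  have h2 : ‖T x‖ ^ 2 ≤ M * ‖x‖ ^ 2 := by
    have := T.le_opNorm x
    calc ‖T x‖ ^ 2 ≤ (‖T‖ * ‖x‖) ^ 2 := by gcongr
      _ = ‖T‖ ^ 2 * ‖x‖ ^ 2 := by ring
      _ ≤ M * ‖x‖ ^ 2 := by gcongr; simp only [M]; nlinarith [sq_nonneg m]
  calc _ ≤ ‖x‖ ^ 2 - 2 * (ε * (m * ‖x‖ ^ 2)) + ε ^ 2 * (M * ‖x‖ ^ 2) := by
        rw [mul_pow]; gcongr
    _ = ‖x‖ ^ 2 - 2 * (ε * (m * ‖x‖ ^ 2)) + ε * (ε * M) * ‖x‖ ^ 2 := by ring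
    _ = q * ‖x‖ ^ 2 := by rw [hεM]; ring

/-- A matrix with positive definite Hermitian part has a principal square root: some positive
multiple of it lies in the open unit ball around `1`. -/
lemma isPrincipalSqrt_principalSqrt
    (hB : ∀ v : Fin d → ℂ, v ≠ 0 → 0 < (star v ⬝ᵥ B *ᵥ v).re) :
    IsPrincipalSqrt B (principalSqrt B) := by
  obtain ⟨ε, hε, h⟩ := norm_one_sub_smul_lt_one hB
  have hex := exists_isPrincipalSqrt_of_norm_lt hε h
  rw [principalSqrt, dif_pos hex]
  exact hex.choose_spec

end

/-! ### Symmetric matrix-valued relaxation functions -/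

lemma IsCompletelyMonotonic.congr {f g : ℝ → ℝ} (hf : IsCompletelyMonotonic f)
    (h : ∀ t, 0 < t → g t = f t) : IsCompletelyMonotonic g := by
  refine ⟨hf.1.congr h, fun m t ht => ?_⟩
  rw [iteratedDerivWithin_congr (fun t ht => h t ht : Set.EqOn g f (Set.Ioi 0)) ht]
  exact hf.2 m t ht

lemma laplaceStieltjes_congr (a : ℝ) {f' g' : ℝ → ℝ} (h : ∀ t, 0 < t → f' t = g' t) (p : ℂ) :
    laplaceStieltjes a f' p = laplaceStieltjes a g' p := by
  rw [laplaceStieltjes, laplaceStieltjes]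
  congr 1
  exact setIntegral_congr_fun measurableSet_Ioi fun t ht => by simp only [h t ht]

lemma laplaceStieltjes_sum {κ : Type*} (s : Finset κ) (c a : κ → ℝ) {f' : κ → ℝ → ℝ}
    (hint : ∀ q ∈ s, IntegrableOn (f' q) (Set.Ioi 0)) {p : ℂ} (hp : 0 ≤ p.re) :
    laplaceStieltjes (∑ q ∈ s, c q * a q) (fun t => ∑ q ∈ s, c q * f' q t) p =
      ∑ q ∈ s, (c q : ℂ) * laplaceStieltjes (a q) (f' q) p := by
  have h : ∀ t : ℝ, Complex.exp (-p * (t : ℂ)) * ((∑ q ∈ s, c q * f' q t : ℝ) : ℂ) =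
      ∑ q ∈ s, (c q : ℂ) * (Complex.exp (-p * (t : ℂ)) * (f' q t : ℂ)) := by
    intro t
    push_cast
    rw [Finset.mul_sum]
    exact Finset.sum_congr rfl fun q _ => by ring
  simp only [laplaceStieltjes, h, mul_add, Finset.sum_add_distrib]
  rw [integral_finsetSum s fun q hq => (integrableOn_exp_mul (hint q hq) hp).const_mul _]
  simp only [integral_const_mul]
  push_cast
  rfl

/-- A matrix-valued function on `]0, ∞[` with symmetric values, completely monotonic quadratic
forms, limit `A₀` at `0` and limit `A₁` at `∞`. -/
structure IsRelaxationMatrix {ι : Type*} [Fintype ι] (A : ℝ → Matrix ι ι ℝ)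
    (A₀ A₁ : Matrix ι ι ℝ) : Prop where
  isSymm : ∀ t, 0 < t → (A t).IsSymm
  completelyMonotonic : ∀ a : ι → ℝ, IsCompletelyMonotonic fun t => a ⬝ᵥ A t *ᵥ a
  tendsto_zero : Tendsto A (𝓝[>] 0) (𝓝 A₀)
  tendsto_atTop : Tendsto A atTop (𝓝 A₁)

/-- The matrix `p ∫ exp (-p t) A t dt` in the form that makes sense for `0 ≤ p.re`. -/
noncomputable def laplaceStieltjesMatrix {ι : Type*} (A : ℝ → Matrix ι ι ℝ) (A₀ : Matrix ι ι ℝ)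
    (p : ℂ) : Matrix ι ι ℂ :=
  Matrix.of fun i k => laplaceStieltjes (A₀ i k) (deriv fun t => A t i k) p

lemma dotProduct_mulVec_eq_sum_prod {ι R : Type*} [Fintype ι] [CommSemiring R]
    (M : Matrix ι ι R) (x y : ι → R) :
    x ⬝ᵥ M *ᵥ y = ∑ q : ι × ι, (x q.1 * y q.2) * M q.1 q.2 := by
  rw [Fintype.sum_prod_type]
  simp only [dotProduct, Matrix.mulVec, Finset.mul_sum]
  exact Finset.sum_congr rfl fun i _ => Finset.sum_congr rfl fun k _ => by ring

lemma apply_eq_polarization_of_isSymm {ι : Type*} [Fintype ι] [DecidableEq ι]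
    {M : Matrix ι ι ℝ} (hM : M.IsSymm) (i k : ι) :
    M i k = 4⁻¹ * ((Pi.single i 1 + Pi.single k 1) ⬝ᵥ M *ᵥ (Pi.single i 1 + Pi.single k 1)) -
      4⁻¹ * ((Pi.single i 1 - Pi.single k 1) ⬝ᵥ M *ᵥ (Pi.single i 1 - Pi.single k 1)) := by
  have := hM.apply i k
  simp [Matrix.mulVec_add, Matrix.mulVec_sub, add_dotProduct, sub_dotProduct, dotProduct_add,
    dotProduct_sub]
  linarith

namespace IsRelaxationMatrix

variable {ι : Type*} [Fintype ι] {A : ℝ → Matrix ι ι ℝ} {A₀ A₁ : Matrix ι ι ℝ}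
  (hA : IsRelaxationMatrix A A₀ A₁)

include hA

lemma tendsto_dotProduct_zero (a : ι → ℝ) :
    Tendsto (fun t => a ⬝ᵥ A t *ᵥ a) (𝓝[>] 0) (𝓝 (a ⬝ᵥ A₀ *ᵥ a)) :=
  ((by fun_prop : Continuous fun M : Matrix ι ι ℝ => a ⬝ᵥ M *ᵥ a).tendsto A₀).comp
    hA.tendsto_zero

lemma tendsto_dotProduct_atTop (a : ι → ℝ) :
    Tendsto (fun t => a ⬝ᵥ A t *ᵥ a) atTop (𝓝 (a ⬝ᵥ A₁ *ᵥ a)) :=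
  ((by fun_prop : Continuous fun M : Matrix ι ι ℝ => a ⬝ᵥ M *ᵥ a).tendsto A₁).comp
    hA.tendsto_atTop

lemma tendsto_apply_zero (i k : ι) : Tendsto (fun t => A t i k) (𝓝[>] 0) (𝓝 (A₀ i k)) :=
  ((by fun_prop : Continuous fun M : Matrix ι ι ℝ => M i k).tendsto A₀).comp hA.tendsto_zero

lemma tendsto_apply_atTop (i k : ι) : Tendsto (fun t => A t i k) atTop (𝓝 (A₁ i k)) :=
  ((by fun_prop : Continuous fun M : Matrix ι ι ℝ => M i k).tendsto A₁).comp hA.tendsto_atTop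

lemma isSymm_zero : A₀.IsSymm := by
  ext i k
  refine tendsto_nhds_unique (hA.tendsto_apply_zero k i)
    ((hA.tendsto_apply_zero i k).congr' ?_)
  filter_upwards [self_mem_nhdsWithin] with t ht using (hA.isSymm t ht).apply k i

lemma hasDerivAt_apply (i k : ι) {t : ℝ} (ht : 0 < t) :
    HasDerivAt (fun t => A t i k) (deriv (fun t => A t i k) t) t := by
  classical
  refine DifferentiableAt.hasDerivAt ?_
  have h := (((hA.completelyMonotonic (Pi.single i 1 + Pi.single k 1)).hasDerivAt ht).const_mul
    4⁻¹).sub (((hA.completelyMonotonic (Pi.single i 1 - Pi.single k 1)).hasDerivAt ht).const_mul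
    4⁻¹)
  refine (h.congr_of_eventuallyEq ?_).differentiableAt
  filter_upwards [Ioi_mem_nhds ht] with s hs
  exact apply_eq_polarization_of_isSymm (hA.isSymm s hs) i k

lemma integrableOn_deriv_apply (i k : ι) :
    IntegrableOn (deriv fun t => A t i k) (Set.Ioi 0) := by
  classical
  have hI := fun a : ι → ℝ => (hA.completelyMonotonic a).integrableOn_deriv
    (hA.tendsto_dotProduct_zero a) (hA.tendsto_dotProduct_atTop a)
  refine IntegrableOn.congr_fun (((hI (Pi.single i 1 + Pi.single k 1)).const_mul 4⁻¹).sub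
    ((hI (Pi.single i 1 - Pi.single k 1)).const_mul 4⁻¹)) (fun t ht => ?_) measurableSet_Ioi
  have h := (((hA.completelyMonotonic (Pi.single i 1 + Pi.single k 1)).hasDerivAt ht).const_mul
    4⁻¹).sub (((hA.completelyMonotonic (Pi.single i 1 - Pi.single k 1)).hasDerivAt ht).const_mul
    4⁻¹)
  refine (HasDerivAt.deriv (h.congr_of_eventuallyEq ?_)).symm
  filter_upwards [Ioi_mem_nhds ht] with s hs
  exact apply_eq_polarization_of_isSymm (hA.isSymm s hs) i k

lemma hasDerivAt_dotProduct (x y : ι → ℝ) {t : ℝ} (ht : 0 < t) :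
    HasDerivAt (fun t => x ⬝ᵥ A t *ᵥ y)
      (x ⬝ᵥ (Matrix.of fun i k => deriv (fun t => A t i k) t) *ᵥ y) t := by
  simp only [dotProduct_mulVec_eq_sum_prod]
  exact HasDerivAt.fun_sum fun q _ => (hA.hasDerivAt_apply q.1 q.2 ht).const_mul _

lemma mul_laplace_apply (i k : ι) {p : ℂ} (hp : 0 < p.re) :
    p * ∫ t in Set.Ioi (0 : ℝ), Complex.exp (-p * (t : ℂ)) * (A t i k : ℂ) =
      laplaceStieltjesMatrix A A₀ p i k :=
  mul_laplace_eq_laplaceStieltjes (fun _ ht => hA.hasDerivAt_apply i k ht)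
    (hA.integrableOn_deriv_apply i k) (hA.tendsto_apply_zero i k) (hA.tendsto_apply_atTop i k) hp

lemma isSymm_laplaceStieltjesMatrix (p : ℂ) : (laplaceStieltjesMatrix A A₀ p).IsSymm := by
  ext i k
  simp only [laplaceStieltjesMatrix, Matrix.transpose_apply, Matrix.of_apply]
  rw [hA.isSymm_zero.apply i k]
  refine laplaceStieltjes_congr _ (fun t ht => Filter.EventuallyEq.deriv_eq ?_) p
  filter_upwards [Ioi_mem_nhds ht] with s hs using (hA.isSymm s hs).apply i k

lemma dotProduct_laplaceStieltjesMatrix (x y : ι → ℝ) {p : ℂ} (hp : 0 ≤ p.re) :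
    (fun i => (x i : ℂ)) ⬝ᵥ laplaceStieltjesMatrix A A₀ p *ᵥ (fun i => (y i : ℂ)) =
      laplaceStieltjes (x ⬝ᵥ A₀ *ᵥ y) (deriv fun t => x ⬝ᵥ A t *ᵥ y) p := by
  rw [laplaceStieltjes_congr _ (fun t ht => (hA.hasDerivAt_dotProduct x y ht).deriv)]
  simp only [dotProduct_mulVec_eq_sum_prod, Matrix.of_apply]
  rw [laplaceStieltjes_sum _ _ _ (fun q _ => hA.integrableOn_deriv_apply q.1 q.2) hp]
  refine Finset.sum_congr rfl fun q _ => ?_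
  simp [laplaceStieltjesMatrix]

lemma le_re_dotProduct (a : ι → ℝ) {p : ℂ} (hp : 0 ≤ p.re) : a ⬝ᵥ A₁ *ᵥ a ≤
    ((fun i => (a i : ℂ)) ⬝ᵥ laplaceStieltjesMatrix A A₀ p *ᵥ (fun i => (a i : ℂ))).re := by
  rw [hA.dotProduct_laplaceStieltjesMatrix a a hp]
  exact (hA.completelyMonotonic a).le_re_laplaceStieltjes (hA.tendsto_dotProduct_zero a)
    (hA.tendsto_dotProduct_atTop a) hp

lemma im_mul_im_dotProduct_nonneg (a : ι → ℝ) {p : ℂ} (hp : 0 ≤ p.re) : 0 ≤ p.im *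
    ((fun i => (a i : ℂ)) ⬝ᵥ laplaceStieltjesMatrix A A₀ p *ᵥ (fun i => (a i : ℂ))).im := by
  rw [hA.dotProduct_laplaceStieltjesMatrix a a hp]
  exact (hA.completelyMonotonic a).im_mul_im_laplaceStieltjes_nonneg
    (hA.tendsto_dotProduct_zero a) (hA.tendsto_dotProduct_atTop a) hp

/-- A direction without dissipation at one frequency does not relax at all: the quadratic form of
`A t` on `a` is constant, so the semidefinite derivative of `A` annihilates `a`. -/
lemma mulVec_eq_of_im_dotProduct_eq_zero (a : ι → ℝ) {p : ℂ} (hp : p.re = 0) (hpi : p.im ≠ 0)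
    (him : ((fun i => (a i : ℂ)) ⬝ᵥ laplaceStieltjesMatrix A A₀ p *ᵥ
      (fun i => (a i : ℂ))).im = 0) {t : ℝ} (ht : 0 < t) : A t *ᵥ a = A₀ *ᵥ a := by
  rw [hA.dotProduct_laplaceStieltjesMatrix a a hp.ge] at him
  have hderiv : ∀ s, 0 < s → (Matrix.of fun i k => deriv (fun t => A t i k) s) *ᵥ a = 0 := by
    intro s hs
    set D : Matrix ι ι ℝ := Matrix.of fun i k => deriv (fun t => A t i k) s
    have hD : (-D).PosSemidef := by
      refine Matrix.PosSemidef.of_dotProduct_mulVec_nonneg ?_ fun x => ?_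
      · ext i k
        simp only [D, Matrix.conjTranspose_apply, Matrix.neg_apply, Matrix.of_apply, star_trivial]
        congr 1
        refine Filter.EventuallyEq.deriv_eq ?_
        filter_upwards [Ioi_mem_nhds hs] with r hr using (hA.isSymm r hr).apply i k
      · have := (hA.completelyMonotonic x).deriv_nonpos hs
        rw [(hA.hasDerivAt_dotProduct x x hs).deriv] at this
        simpa [Matrix.neg_mulVec] using this
    have h0 := (hA.completelyMonotonic a).deriv_eq_zero_of_im_laplaceStieltjes_eq_zero
      (hA.tendsto_dotProduct_zero a) (hA.tendsto_dotProduct_atTop a) hp hpi him hs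
    rw [(hA.hasDerivAt_dotProduct a a hs).deriv] at h0
    have h1 := (hD.dotProduct_mulVec_zero_iff a).1 (by simpa [Matrix.neg_mulVec] using h0)
    simpa [Matrix.neg_mulVec] using h1
  classical
  ext i
  -- the function `A t a` has derivative zero on `]0, ∞[`, hence equals its limit at `0`
  have hd : ∀ s, 0 < s → HasDerivAt (fun s => Pi.single i 1 ⬝ᵥ A s *ᵥ a) 0 s := by
    intro s hs
    have := hA.hasDerivAt_dotProduct (Pi.single i 1) a hs
    rwa [hderiv s hs, dotProduct_zero] at this
  have hconst : ∀ s, 0 < s → (A s *ᵥ a) i = (A t *ᵥ a) i := by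
    intro s hs
    have := isOpen_Ioi.is_const_of_deriv_eq_zero (convex_Ioi (0 : ℝ)).isPreconnected
      (fun s hs => (hd s hs).differentiableAt.differentiableWithinAt)
      (fun s hs => (hd s hs).deriv) (Set.mem_Ioi.2 hs) (Set.mem_Ioi.2 ht)
    simpa using this
  have hlim : Tendsto (fun s => (A s *ᵥ a) i) (𝓝[>] 0) (𝓝 ((A₀ *ᵥ a) i)) :=
    ((by fun_prop : Continuous fun M : Matrix ι ι ℝ => (M *ᵥ a) i).tendsto A₀).comp
      hA.tendsto_zero
  refine tendsto_nhds_unique (tendsto_const_nhds.congr' ?_) hlim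
  filter_upwards [self_mem_nhdsWithin] with s hs using (hconst s hs).symm

lemma laplaceStieltjesMatrix_mulVec_of_const {a w : ι → ℝ} (h : ∀ t, 0 < t → A t *ᵥ a = w)
    {p : ℂ} (hp : 0 ≤ p.re) :
    laplaceStieltjesMatrix A A₀ p *ᵥ (fun i => (a i : ℂ)) = fun i => (w i : ℂ) := by
  classical
  have hw : A₀ *ᵥ a = w := by
    have hlim : Tendsto (fun s => A s *ᵥ a) (𝓝[>] 0) (𝓝 (A₀ *ᵥ a)) :=
      ((by fun_prop : Continuous fun M : Matrix ι ι ℝ => M *ᵥ a).tendsto A₀).comp hA.tendsto_zero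
    refine tendsto_nhds_unique hlim (tendsto_const_nhds.congr' ?_)
    filter_upwards [self_mem_nhdsWithin] with s hs using (h s hs).symm
  ext i
  have h1 := hA.dotProduct_laplaceStieltjesMatrix (Pi.single i 1) a hp
  have h2 : (fun j => ((Pi.single i 1 : ι → ℝ) j : ℂ)) = Pi.single i 1 := by
    ext j; by_cases hj : j = i <;> simp [hj]
  have h3 : ∀ t, 0 < t → deriv (fun t => Pi.single i 1 ⬝ᵥ A t *ᵥ a) t = 0 := by
    intro t ht
    have : (fun t => Pi.single i 1 ⬝ᵥ A t *ᵥ a) =ᶠ[𝓝 t] fun _ => w i := by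
      filter_upwards [Ioi_mem_nhds ht] with s hs
      rw [h s hs, single_one_dotProduct]
    rw [this.deriv_eq, deriv_const]
  rw [h2, single_one_dotProduct, single_one_dotProduct, hw,
    laplaceStieltjes_congr (g' := fun _ => 0) _ h3] at h1
  rw [h1]
  simp [laplaceStieltjes]

end IsRelaxationMatrix

/-! ### Spectrum of the wave matrix -/

/-- For a complex symmetric matrix the cross terms of real and imaginary part cancel. -/
lemma star_dotProduct_mulVec_of_isSymm {ι : Type*} [Fintype ι] {B : Matrix ι ι ℂ}
    (hB : B.IsSymm) (v : ι → ℂ) : star v ⬝ᵥ B *ᵥ v =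
      (fun i => ((v i).re : ℂ)) ⬝ᵥ B *ᵥ (fun i => ((v i).re : ℂ)) +
      (fun i => ((v i).im : ℂ)) ⬝ᵥ B *ᵥ (fun i => ((v i).im : ℂ)) := by
  set a : ι → ℂ := fun i => ((v i).re : ℂ)
  set b : ι → ℂ := fun i => ((v i).im : ℂ)
  have hv : v = a + Complex.I • b := by
    ext i
    simp only [a, b, Pi.add_apply, Pi.smul_apply, smul_eq_mul]
    rw [mul_comm, Complex.re_add_im]
  have hsv : star v = a - Complex.I • b := by
    ext i
    simp only [a, b, Pi.sub_apply, Pi.smul_apply, smul_eq_mul, Pi.star_apply]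
    apply Complex.ext <;> simp
  have hab : b ⬝ᵥ B *ᵥ a = a ⬝ᵥ B *ᵥ b := by
    rw [Matrix.dotProduct_mulVec, ← Matrix.mulVec_transpose, hB.eq, dotProduct_comm]
  rw [hsv]
  nth_rewrite 1 [hv]
  simp only [Matrix.mulVec_add, Matrix.mulVec_smul, dotProduct_add, sub_dotProduct,
    dotProduct_smul, smul_dotProduct, smul_eq_mul, hab]
  linear_combination (-(b ⬝ᵥ B *ᵥ b)) * Complex.I_mul_I

lemma exists_mulVec_eq_smul_of_mem_spectrum {ι : Type*} [Fintype ι] [DecidableEq ι]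
    {B : Matrix ι ι ℂ} {z : ℂ} (hz : z ∈ spectrum ℂ B) : ∃ v, v ≠ 0 ∧ B *ᵥ v = z • v := by
  rw [← Matrix.spectrum_toLin', ← Module.End.hasEigenvalue_iff_mem_spectrum] at hz
  obtain ⟨v, hv⟩ := hz.exists_hasEigenvector
  exact ⟨v, hv.2, by simpa using hv.apply_eq_smul⟩

lemma mem_spectrum_of_mulVec_eq_smul {ι : Type*} [Fintype ι] [DecidableEq ι]
    {B : Matrix ι ι ℂ} {z : ℂ} {v : ι → ℂ} (hv : v ≠ 0) (h : B *ᵥ v = z • v) :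
    z ∈ spectrum ℂ B := by
  rw [← Matrix.spectrum_toLin', ← Module.End.hasEigenvalue_iff_mem_spectrum]
  exact Module.End.hasEigenvalue_of_hasEigenvector
    (Module.End.hasEigenvector_iff.2 ⟨Module.End.mem_eigenspace_iff.2 (by simpa using h), hv⟩)

lemma IsPrincipalSqrt.isUnit {d : ℕ} {B Y : Matrix (Fin d) (Fin d) ℂ} (h : IsPrincipalSqrt B Y) :
    IsUnit Y := by
  by_contra hY
  exact lt_irrefl _ (h.2 0 (spectrum.zero_mem ℂ hY))

namespace IsRelaxationMatrix

variable {ι : Type*} [Fintype ι] {A : ℝ → Matrix ι ι ℝ} {A₀ A₁ : Matrix ι ι ℝ}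
  (hA : IsRelaxationMatrix A A₀ A₁)

include hA

lemma re_star_dotProduct_pos (hpos : ∀ a, a ≠ 0 → 0 < a ⬝ᵥ A₁ *ᵥ a) {p : ℂ} (hp : 0 ≤ p.re)
    {v : ι → ℂ} (hv : v ≠ 0) : 0 < (star v ⬝ᵥ laplaceStieltjesMatrix A A₀ p *ᵥ v).re := by
  rw [star_dotProduct_mulVec_of_isSymm (hA.isSymm_laplaceStieltjesMatrix p), Complex.add_re]
  have h1 := hA.le_re_dotProduct (fun i => (v i).re) hp
  have h2 := hA.le_re_dotProduct (fun i => (v i).im) hp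
  have hnn : ∀ a : ι → ℝ, 0 ≤ a ⬝ᵥ A₁ *ᵥ a := fun a => by
    rcases eq_or_ne a 0 with rfl | ha
    · simp
    · exact (hpos a ha).le
  by_cases hre : (fun i => (v i).re) = 0
  · have him : (fun i => (v i).im) ≠ 0 := fun him =>
      hv (funext fun i => Complex.ext (congrFun hre i) (congrFun him i))
    linarith [hnn fun i => (v i).re, hpos _ him]
  · linarith [hpos _ hre, hnn fun i => (v i).im]

open scoped ComplexOrder in
lemma im_mul_im_eigenvalue_nonneg {p : ℂ} (hp : 0 ≤ p.re) {v : ι → ℂ} (hv : v ≠ 0) {l : ℂ}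
    (h : laplaceStieltjesMatrix A A₀ p *ᵥ v = l • v) : 0 ≤ p.im * l.im := by
  have h1 := star_dotProduct_mulVec_of_isSymm (hA.isSymm_laplaceStieltjesMatrix p) v
  obtain ⟨hs, hs'⟩ := Complex.pos_iff.1 (Matrix.dotProduct_star_self_pos_iff.2 hv)
  rw [h, dotProduct_smul, smul_eq_mul] at h1
  have h2 := congrArg Complex.im h1
  rw [Complex.mul_im, ← hs', mul_zero, zero_add, Complex.add_im] at h2
  have h3 := hA.im_mul_im_dotProduct_nonneg (fun i => (v i).re) hp
  have h4 := hA.im_mul_im_dotProduct_nonneg (fun i => (v i).im) hp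
  have h5 : 0 ≤ (p.im * l.im) * (star v ⬝ᵥ v).re := by
    rw [mul_assoc, h2, mul_add]
    exact add_nonneg h3 h4
  exact nonneg_of_mul_nonneg_left h5 hs

open scoped ComplexOrder in
/-- On the punctured imaginary axis a real eigenvalue comes from a mode that does not relax: the
real and the imaginary part of the eigenvector are free of dissipation. -/
lemma exists_mulVec_eq_smul_of_im_eigenvalue_eq_zero {p : ℂ} (hp : p.re = 0) (hpi : p.im ≠ 0)
    {v : ι → ℂ} (hv : v ≠ 0) {l : ℂ} (h : laplaceStieltjesMatrix A A₀ p *ᵥ v = l • v)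
    (hl : l.im = 0) : ∃ a : ι → ℝ, a ≠ 0 ∧ ∀ t, 0 < t → A t *ᵥ a = l.re • a := by
  have h1 := star_dotProduct_mulVec_of_isSymm (hA.isSymm_laplaceStieltjesMatrix p) v
  have hs' := (Complex.pos_iff.1 (Matrix.dotProduct_star_self_pos_iff.2 hv)).2
  rw [h, dotProduct_smul, smul_eq_mul] at h1
  have h2 := congrArg Complex.im h1
  rw [Complex.mul_im, ← hs', hl, mul_zero, zero_mul, zero_add, Complex.add_im] at h2
  have h3 := hA.im_mul_im_dotProduct_nonneg (fun i => (v i).re) hp.ge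
  have h4 := hA.im_mul_im_dotProduct_nonneg (fun i => (v i).im) hp.ge
  have h5 := congrArg (p.im * ·) h2
  simp only [mul_zero, mul_add] at h5
  have ha := fun t ht => hA.mulVec_eq_of_im_dotProduct_eq_zero (fun i => (v i).re) hp hpi
    ((mul_eq_zero.1 (by linarith)).resolve_left hpi) (t := t) ht
  have hb := fun t ht => hA.mulVec_eq_of_im_dotProduct_eq_zero (fun i => (v i).im) hp hpi
    ((mul_eq_zero.1 (by linarith)).resolve_left hpi) (t := t) ht
  have hv' : v = (fun i => ((v i).re : ℂ)) + Complex.I • (fun i => ((v i).im : ℂ)) := by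
    ext i
    simp only [Pi.add_apply, Pi.smul_apply, smul_eq_mul]
    rw [mul_comm, Complex.re_add_im]
  have hsplit : laplaceStieltjesMatrix A A₀ p *ᵥ v =
      (fun i => ((A₀ *ᵥ fun i => (v i).re) i : ℂ)) +
        Complex.I • (fun i => ((A₀ *ᵥ fun i => (v i).im) i : ℂ)) := by
    nth_rewrite 1 [hv']
    rw [Matrix.mulVec_add, Matrix.mulVec_smul, hA.laplaceStieltjesMatrix_mulVec_of_const ha hp.ge,
      hA.laplaceStieltjesMatrix_mulVec_of_const hb hp.ge]
  rw [h] at hsplit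
  have hre : A₀ *ᵥ (fun i => (v i).re) = l.re • fun i => (v i).re := by
    ext i
    have := congrArg Complex.re (congrFun hsplit i)
    simpa [hl] using this.symm
  have him : A₀ *ᵥ (fun i => (v i).im) = l.re • fun i => (v i).im := by
    ext i
    have := congrArg Complex.im (congrFun hsplit i)
    simpa [hl] using this.symm
  by_cases h0 : (fun i => (v i).re) = 0
  · refine ⟨fun i => (v i).im, fun him => hv ?_, fun t ht => (hb t ht).trans him⟩
    exact funext fun i => Complex.ext (congrFun h0 i) (congrFun him i)
  · exact ⟨_, h0, fun t ht => (ha t ht).trans hre⟩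

end IsRelaxationMatrix

/-- An eigenvalue `z` of `(c p) Y⁻¹` is `c p / y` for an eigenvalue `y` of `Y`, and `y²` is an
eigenvalue of `Y²`. As `Im p` and `Im y` have the same sign, `p` and `y` lie in the same quadrant,
hence `Re z > 0` unless `p` is imaginary and `y` real. -/
lemma IsPrincipalSqrt.re_pos_of_mem_spectrum {d : ℕ} {A : ℝ → Matrix (Fin d) (Fin d) ℝ}
    {A₀ A₁ : Matrix (Fin d) (Fin d) ℝ} (hA : IsRelaxationMatrix A A₀ A₁)
    {p : ℂ} (hp : 0 ≤ p.re) (hp0 : p ≠ 0) {Y : Matrix (Fin d) (Fin d) ℂ}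
    (hY : IsPrincipalSqrt (laplaceStieltjesMatrix A A₀ p) Y)
    (hmode : p.re = 0 → ¬ ∃ a : Fin d → ℝ, a ≠ 0 ∧ ∃ c : ℝ, ∀ t, 0 < t → A t *ᵥ a = c • a)
    {c : ℝ} (hc : 0 < c) {z : ℂ} (hz : z ∈ spectrum ℂ (((c : ℂ) * p) • Y⁻¹)) : 0 < z.re := by
  obtain ⟨v, hv, hzv⟩ := exists_mulVec_eq_smul_of_mem_spectrum hz
  have hdet := (Matrix.isUnit_iff_isUnit_det Y).1 hY.isUnit
  have hc0 : (c : ℂ) ≠ 0 := by exact_mod_cast hc.ne'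
  have h1 : ((c : ℂ) * p) • v = z • Y *ᵥ v := by
    rw [← Matrix.mulVec_smul, ← hzv, Matrix.smul_mulVec, Matrix.mulVec_smul, Matrix.mulVec_mulVec,
      Matrix.mul_nonsing_inv _ hdet, Matrix.one_mulVec]
  have hz0 : z ≠ 0 := by
    rintro rfl
    rw [zero_smul, smul_eq_zero] at h1
    exact h1.elim (mul_ne_zero hc0 hp0) hv
  set y := (c : ℂ) * p / z
  have hy : Y *ᵥ v = y • v := by
    simp only [y]
    rw [div_eq_inv_mul, mul_smul, h1, smul_smul, inv_mul_cancel₀ hz0, one_smul]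
  have hyre : 0 < y.re := hY.2 y (mem_spectrum_of_mulVec_eq_smul hv hy)
  have hl : laplaceStieltjesMatrix A A₀ p *ᵥ v = (y * y) • v := by
    rw [← hY.1, ← Matrix.mulVec_mulVec, hy, Matrix.mulVec_smul, hy, smul_smul]
  have him := hA.im_mul_im_eigenvalue_nonneg hp hv hl
  have hyim : (y * y).im = 2 * y.re * y.im := by rw [Complex.mul_im]; ring
  have hsign : 0 ≤ p.im * y.im := by
    rw [hyim] at him
    have : 0 ≤ p.im * y.im * (2 * y.re) := by linarith
    exact nonneg_of_mul_nonneg_left this (by linarith)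
  have hy0 : y ≠ 0 := fun h => by simp [h] at hyre
  have hzy : z = (c : ℂ) * p / y := by
    simp only [y]; field_simp
  have hnum : 0 < p.re * y.re + p.im * y.im := by
    rcases hp.lt_or_eq with h | h
    · exact add_pos_of_pos_of_nonneg (mul_pos h hyre) hsign
    · have hpi : p.im ≠ 0 := fun hi => hp0 (Complex.ext h.symm hi)
      have hyi : y.im ≠ 0 := fun hi => by
        obtain ⟨a, ha, hmod⟩ := hA.exists_mulVec_eq_smul_of_im_eigenvalue_eq_zero h.symm hpi hv hl
          (by rw [hyim, hi, mul_zero])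
        exact hmode h.symm ⟨a, ha, _, hmod⟩
      rw [← h, zero_mul, zero_add]
      exact lt_of_le_of_ne hsign (mul_ne_zero hpi hyi).symm
  have hN : 0 < Complex.normSq y := Complex.normSq_pos.2 hy0
  rw [hzy, Complex.div_re]
  simp only [Complex.re_ofReal_mul, Complex.im_ofReal_mul]
  rw [← add_div]
  refine div_pos ?_ hN
  nlinarith

/-! ### The acoustic matrix of a relaxation modulus -/

/-- A rank-4 tensor as a matrix indexed by pairs, that is, as an operator on all rank-2 tensors. -/
def tensorMatrix {R : Type*} {d : ℕ} (C : Tensor4 R d) :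
    Matrix (Fin d × Fin d) (Fin d × Fin d) R :=
  Matrix.of fun q r => C q.1 q.2 r.1 r.2

/-- The rank-2 tensor `e_i ⊗ n`, as a vector indexed by pairs. The entries of the acoustic matrix
are the values of the bilinear form of `tensorMatrix` on these vectors. -/
def unitTensor {d : ℕ} (n : EuclideanSpace ℝ (Fin d)) (i : Fin d) : Fin d × Fin d → ℝ :=
  fun q => if q.1 = i then n q.2 else 0

section

variable {d : ℕ}

lemma dotProduct_tensorMatrix (C : Tensor4 ℝ d) (a : Fin d × Fin d → ℝ) :
    a ⬝ᵥ tensorMatrix C *ᵥ a = quadForm C (Matrix.of fun i j => a (i, j)) := by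
  simp only [dotProduct, Matrix.mulVec, tensorMatrix, quadForm, Matrix.of_apply,
    Fintype.sum_prod_type, Finset.mul_sum, mul_assoc]

lemma quadForm_symmetrize {C : Tensor4 ℝ d} (hC : IsSymmTensor4 C)
    (E : Matrix (Fin d) (Fin d) ℝ) :
    quadForm C ((2⁻¹ : ℝ) • (E + Eᵀ)) = quadForm C E := by
  have h1 : ∀ F : Matrix (Fin d) (Fin d) ℝ,
      ∑ i, ∑ j, ∑ k, ∑ l, Eᵀ i j * C i j k l * F k l =
        ∑ i, ∑ j, ∑ k, ∑ l, E i j * C i j k l * F k l := by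
    intro F
    rw [Finset.sum_comm]
    refine Finset.sum_congr rfl fun i _ => Finset.sum_congr rfl fun j _ =>
      Finset.sum_congr rfl fun k _ => Finset.sum_congr rfl fun l _ => ?_
    rw [Matrix.transpose_apply, (hC j i k l).1]
  have h2 : ∀ F : Matrix (Fin d) (Fin d) ℝ,
      ∑ i, ∑ j, ∑ k, ∑ l, F i j * C i j k l * Eᵀ k l =
        ∑ i, ∑ j, ∑ k, ∑ l, F i j * C i j k l * E k l := by
    intro F
    refine Finset.sum_congr rfl fun i _ => Finset.sum_congr rfl fun j _ => ?_
    rw [Finset.sum_comm]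
    refine Finset.sum_congr rfl fun k _ => Finset.sum_congr rfl fun l _ => ?_
    rw [Matrix.transpose_apply, (hC i j l k).2.1]
  have h3 : quadForm C ((2⁻¹ : ℝ) • (E + Eᵀ)) = 4⁻¹ *
      (∑ i, ∑ j, ∑ k, ∑ l, E i j * C i j k l * E k l +
        ∑ i, ∑ j, ∑ k, ∑ l, Eᵀ i j * C i j k l * E k l +
        ∑ i, ∑ j, ∑ k, ∑ l, E i j * C i j k l * Eᵀ k l +
        ∑ i, ∑ j, ∑ k, ∑ l, Eᵀ i j * C i j k l * Eᵀ k l) := by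
    simp only [quadForm, ← Finset.sum_add_distrib, Finset.mul_sum]
    refine Finset.sum_congr rfl fun i _ => Finset.sum_congr rfl fun j _ =>
      Finset.sum_congr rfl fun k _ => Finset.sum_congr rfl fun l _ => ?_
    simp only [Matrix.smul_apply, Matrix.add_apply, smul_eq_mul]
    ring
  rw [h3, h2 Eᵀ, h2 E, h1 E, quadForm]
  ring

lemma isSymm_symmetrize (E : Matrix (Fin d) (Fin d) ℝ) : ((2⁻¹ : ℝ) • (E + Eᵀ)).IsSymm := by
  ext i j
  simp [← mul_add, add_comm]

lemma acousticMatrix_apply_real (C : Tensor4 ℝ d) (n : EuclideanSpace ℝ (Fin d)) (i k : Fin d) :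
    acousticMatrix C n i k = unitTensor n i ⬝ᵥ tensorMatrix C *ᵥ unitTensor n k := by
  simp only [acousticMatrix, unitTensor, tensorMatrix, dotProduct, Matrix.mulVec, Matrix.of_apply,
    Fintype.sum_prod_type, smul_eq_mul]
  simp [Finset.mul_sum, Finset.sum_ite_irrel]
  exact Finset.sum_congr rfl fun j _ => Finset.sum_congr rfl fun l _ => by ring

lemma acousticMatrix_apply_complex (C : Tensor4 ℂ d) (n : EuclideanSpace ℝ (Fin d))
    (i k : Fin d) : acousticMatrix C n i k =
      (fun q => (unitTensor n i q : ℂ)) ⬝ᵥ tensorMatrix C *ᵥ (fun q => (unitTensor n k q : ℂ)) := by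
  simp only [acousticMatrix, unitTensor, tensorMatrix, dotProduct, Matrix.mulVec, Matrix.of_apply,
    Fintype.sum_prod_type, Complex.real_smul]
  simp [Finset.mul_sum, apply_ite Complex.ofReal, Finset.sum_ite_irrel]
  exact Finset.sum_congr rfl fun j _ => Finset.sum_congr rfl fun l _ => by ring

lemma dotProduct_acousticMatrix (C : Tensor4 ℝ d) (n : EuclideanSpace ℝ (Fin d))
    (a : Fin d → ℝ) :
    a ⬝ᵥ acousticMatrix C n *ᵥ a = quadForm C (Matrix.vecMulVec a n.ofLp) := by
  simp only [dotProduct, Matrix.mulVec, acousticMatrix, quadForm, Matrix.of_apply, smul_eq_mul,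
    Matrix.vecMulVec_apply, Finset.mul_sum, Finset.sum_mul]
  refine Finset.sum_congr rfl fun i _ => ?_
  rw [Finset.sum_comm]
  refine Finset.sum_congr rfl fun j _ => Finset.sum_congr rfl fun k _ =>
    Finset.sum_congr rfl fun l _ => ?_
  ring

/-- For a unit vector `n` the symmetric part of `a ⊗ n` vanishes only for `a = 0`: contracting
`a ⊗ n + n ⊗ a = 0` with `n` gives `a + ⟨a, n⟩ n = 0`, and contracting once more `2 ⟨a, n⟩ = 0`. -/
lemma symmetrize_vecMulVec_ne_zero {n : EuclideanSpace ℝ (Fin d)} (hn : ‖n‖ = 1)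
    {a : Fin d → ℝ} (ha : a ≠ 0) :
    (2⁻¹ : ℝ) • (Matrix.vecMulVec a n.ofLp + (Matrix.vecMulVec a n.ofLp)ᵀ) ≠ 0 := by
  intro h0
  apply ha
  have hnn : n.ofLp ⬝ᵥ n.ofLp = 1 := by
    have := EuclideanSpace.real_norm_sq_eq n
    rw [hn] at this
    simp only [dotProduct, ← pow_two, ← this, one_pow]
  have h1 : Matrix.vecMulVec a n.ofLp + (Matrix.vecMulVec a n.ofLp)ᵀ = 0 :=
    (smul_eq_zero.1 h0).resolve_left (by norm_num)
  have h2 := congrArg (· *ᵥ n.ofLp) h1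
  simp only [Matrix.transpose_vecMulVec, Matrix.add_mulVec, Matrix.vecMulVec_mulVec,
    Matrix.zero_mulVec, hnn] at h2
  have h3 := congrArg (n.ofLp ⬝ᵥ ·) h2
  simp [dotProduct_add, hnn, dotProduct_comm n.ofLp a] at h2 h3
  have h4 : a ⬝ᵥ n.ofLp = 0 := by linarith
  simpa [h4] using h2

end

section

variable {d : ℕ} {G : ℝ → Tensor4 ℝ d} (hG : IsSolidRelaxationModulus G) {G₀ G₁ : Tensor4 ℝ d}
  (h₀ : Tendsto G (𝓝[>] 0) (𝓝 G₀)) (h₁ : Tendsto G atTop (𝓝 G₁))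

include hG in
/-- The minor symmetries extend complete monotonicity from symmetric to arbitrary `E`, so that
polarization may use the matrix units. -/
lemma IsSolidRelaxationModulus.isCompletelyMonotonic_quadForm (E : Matrix (Fin d) (Fin d) ℝ) :
    IsCompletelyMonotonic fun t => quadForm (G t) E :=
  (hG.completelyMonotonic _ (isSymm_symmetrize E)).congr fun t ht =>
    (quadForm_symmetrize (hG.symm t ht) E).symm

include hG h₀ h₁ in
lemma IsSolidRelaxationModulus.isRelaxationMatrix_tensorMatrix :
    IsRelaxationMatrix (fun t => tensorMatrix (G t)) (tensorMatrix G₀) (tensorMatrix G₁) := by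
  have hc : Continuous (tensorMatrix : Tensor4 ℝ d → _) := by unfold tensorMatrix; fun_prop
  refine ⟨fun t ht => ?_, fun a => ?_, (hc.tendsto _).comp h₀, (hc.tendsto _).comp h₁⟩
  · ext q r
    exact (hG.symm t ht _ _ _ _).2.2
  · simp only [dotProduct_tensorMatrix]
    exact hG.isCompletelyMonotonic_quadForm _

include hG h₀ h₁ in
lemma IsSolidRelaxationModulus.isRelaxationMatrix_acousticMatrix (n : EuclideanSpace ℝ (Fin d)) :
    IsRelaxationMatrix (fun t => acousticMatrix (G t) n) (acousticMatrix G₀ n)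
      (acousticMatrix G₁ n) := by
  have hc : Continuous fun C : Tensor4 ℝ d => acousticMatrix C n := by
    unfold acousticMatrix; fun_prop
  refine ⟨fun t ht => ?_, fun a => ?_, (hc.tendsto _).comp h₀, (hc.tendsto _).comp h₁⟩
  · ext i k
    simp only [Matrix.transpose_apply, acousticMatrix, Matrix.of_apply]
    rw [Finset.sum_comm]
    refine Finset.sum_congr rfl fun j _ => Finset.sum_congr rfl fun l _ => ?_
    rw [mul_comm, (hG.symm t ht k l i j).2.2]
  · simp only [dotProduct_acousticMatrix]
    exact hG.isCompletelyMonotonic_quadForm _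

include h₁ hG in
lemma IsSolidRelaxationModulus.dotProduct_acousticMatrix_pos
    (hpos : ∀ E : Matrix (Fin d) (Fin d) ℝ, E.IsSymm → E ≠ 0 → 0 < quadForm G₁ E)
    {n : EuclideanSpace ℝ (Fin d)} (hn : ‖n‖ = 1) {a : Fin d → ℝ} (ha : a ≠ 0) :
    0 < a ⬝ᵥ acousticMatrix G₁ n *ᵥ a := by
  have hq : ∀ E, Tendsto (fun t => quadForm (G t) E) atTop (𝓝 (quadForm G₁ E)) := fun E =>
    ((by unfold quadForm; fun_prop : Continuous fun C : Tensor4 ℝ d => quadForm C E).tendsto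
      G₁).comp h₁
  have hsymm : ∀ E, quadForm G₁ ((2⁻¹ : ℝ) • (E + Eᵀ)) = quadForm G₁ E := fun E => by
    refine tendsto_nhds_unique (hq _) ((hq E).congr' ?_)
    filter_upwards [eventually_gt_atTop 0] with t ht
    exact (quadForm_symmetrize (hG.symm t ht) E).symm
  rw [dotProduct_acousticMatrix, ← hsymm]
  exact hpos _ (isSymm_symmetrize _) (symmetrize_vecMulVec_ne_zero hn ha)

include hG h₀ h₁ in
/-- On the imaginary axis the limit defining the modulus exists, because the right-hand side is
continuous there. -/
lemma IsSolidRelaxationModulus.tensorMatrix_modulus {p : ℂ} (hp : 0 ≤ p.re) :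
    tensorMatrix (modulus G p) =
      laplaceStieltjesMatrix (fun t => tensorMatrix (G t)) (tensorMatrix G₀) p := by
  have hT := hG.isRelaxationMatrix_tensorMatrix h₀ h₁
  let Φ : ℂ → Tensor4 ℂ d := fun q i j k l =>
    laplaceStieltjesMatrix (fun t => tensorMatrix (G t)) (tensorMatrix G₀) q (i, j) (k, l)
  have hΦ : ∀ q : ℂ, 0 < q.re → laplaceModulus G q = Φ q := fun q hq => by
    funext i j k l
    exact hT.mul_laplace_apply (i, j) (k, l) hq
  suffices h : modulus G p = Φ p by rw [h]; rfl
  rw [modulus]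
  split_ifs with h
  · exact hΦ p h
  · have hcont : ContinuousWithinAt Φ {z : ℂ | 0 < z.re} p := by
      refine continuousWithinAt_pi.2 fun i => continuousWithinAt_pi.2 fun j =>
        continuousWithinAt_pi.2 fun k => continuousWithinAt_pi.2 fun l => ?_
      exact continuousWithinAt_laplaceStieltjes _ (hT.integrableOn_deriv_apply (i, j) (k, l)) p
    have hne : (𝓝[{z : ℂ | 0 < z.re}] p).NeBot := by
      rw [← mem_closure_iff_nhdsWithin_neBot, Complex.closure_setOfPred_lt_re]
      exact hp
    refine Tendsto.limUnder_eq (hcont.tendsto.congr' ?_)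
    filter_upwards [self_mem_nhdsWithin] with q hq using (hΦ q hq).symm

include hG h₀ h₁ in
lemma IsSolidRelaxationModulus.acousticMatrix_modulus (n : EuclideanSpace ℝ (Fin d)) {p : ℂ}
    (hp : 0 ≤ p.re) : acousticMatrix (modulus G p) n =
      laplaceStieltjesMatrix (fun t => acousticMatrix (G t) n) (acousticMatrix G₀ n) p := by
  ext i k
  rw [acousticMatrix_apply_complex, hG.tensorMatrix_modulus h₀ h₁ hp,
    (hG.isRelaxationMatrix_tensorMatrix h₀ h₁).dotProduct_laplaceStieltjesMatrix _ _ hp]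
  simp only [laplaceStieltjesMatrix, Matrix.of_apply, acousticMatrix_apply_real]

end

end Viscoelastic

theorem mainTheorem3 {d : ℕ} (ρ : ℝ) (hρ : 0 < ρ)
    (G : ℝ → Viscoelastic.Tensor4 ℝ d) (hG : Viscoelastic.IsSolidRelaxationModulus G)
    (n : EuclideanSpace ℝ (Fin d)) (hn : ‖n‖ = 1) (p : ℂ) (hp : 0 ≤ p.re) :
    (Viscoelastic.waveMatrix ρ G n p ≠ 0 ↔ p ≠ 0) ∧
    (Viscoelastic.waveMatrix ρ G n p ≠ 0 →
      (p.re = 0 → ¬ Viscoelastic.HasElasticMode G n) →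
        ∀ z ∈ spectrum ℂ (Viscoelastic.waveMatrix ρ G n p), 0 < z.re) := by
  obtain ⟨G₀, h₀⟩ := hG.limit_zero
  obtain ⟨G₁, h₁, hpos⟩ := hG.limit_infty
  have hA := hG.isRelaxationMatrix_acousticMatrix h₀ h₁ n
  have hc : 0 < Real.sqrt ρ := Real.sqrt_pos.2 hρ
  have hY := Viscoelastic.isPrincipalSqrt_principalSqrt fun v hv => hA.re_star_dotProduct_pos
    (fun a ha => hG.dotProduct_acousticMatrix_pos h₁ hpos hn ha) hp (v := v) hv
  have hp0 : Viscoelastic.waveMatrix ρ G n p ≠ 0 → p ≠ 0 := by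
    rintro hK rfl
    exact hK (by simp [Viscoelastic.waveMatrix])
  have hK : Viscoelastic.waveMatrix ρ G n p = ((Real.sqrt ρ : ℂ) * p) •
      (Viscoelastic.principalSqrt (Viscoelastic.laplaceStieltjesMatrix
        (fun t => Viscoelastic.acousticMatrix (G t) n) (Viscoelastic.acousticMatrix G₀ n)
          p))⁻¹ := by
    rw [Viscoelastic.waveMatrix, hG.acousticMatrix_modulus h₀ h₁ n hp]
  refine ⟨⟨hp0, fun hp0 => ?_⟩, fun hK0 hmode z hz => ?_⟩
  · -- as `n ≠ 0` the dimension is positive, so an invertible matrix is nonzero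
    have hd : Nonempty (Fin d) := by
      by_contra hd
      rw [not_nonempty_iff] at hd
      simp [Subsingleton.elim n 0] at hn
    have hc0 : ((Real.sqrt ρ : ℝ) : ℂ) ≠ 0 := by exact_mod_cast hc.ne'
    rw [hK]
    refine smul_ne_zero (mul_ne_zero hc0 hp0) ?_
    exact (Matrix.isUnit_nonsing_inv_iff.2 hY.isUnit).ne_zero
  · rw [hK] at hz
    exact hY.re_pos_of_mem_spectrum hA hp (hp0 hK0) hmode hc hz
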